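/- Let $Y_1,Y_2$ be random variables with finite alphabets $\mathcal Y_1,\mathcal Y_2$ and joint pmf $P_{Y_1,Y_2}$. For $i\in\{1,2\}$ let $i^{\mathsf c}$ be the other index. The (Berger--Tung) rate-distortion region $\mathcal{RD}_{\mathrm{BT}}$ of the two-encoder multiterminal source coding problem under logarithmic loss is, in single-letter form, the set of all $(R_1,R_2,D_1,D_2)\in\mathbb R^4$ such that $$R_i\ge I(U_i;Y_i\mid U_{i^{\mathsf c}},Q)\ \ (i=1,2),\qquad R_1+R_2\ge I(U_1,U_2;Y_1,Y_2\mid Q),\qquad D_i\ge H(Y_i\mid U_1,U_2,Q)\ \ (i=1,2)$$ for some joint pmf of the form $p(y_1,y_2)\,p(u_1|y_1,q)\,p(u_2|y_2,q)\,p(q)$ with $|\mathcal U_1|\le|\mathcal Y_1|$, $|\mathcal U_2|\le|\mathcal Y_2|$ and $|\mathcal Q|\le 5$. For $i\in\{1,2\}$, $\alpha\in[0,1]$ and $(R_1,R_2)\in\mathbb R^2$ let $$D^{i}_{\mathrm{BT},\alpha}(R_1,R_2)=\min\ \alpha H(Y_1\mid U_1,U_2)+(1-\alpha)H(Y_2\mid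 U_1,U_2)\quad\text{s.t.}\quad R_i\ge I(Y_i;U_i\mid U_{i^{\mathsf c}}),\ \ R_{i^{\mathsf c}}\ge I(Y_{i^{\mathsf c}};U_{i^{\mathsf c}}),$$ where the minimum (read as an infimum, equal to $+\infty$ if the constraints cannot be met) is over all joint pmfs $P_{U_1,U_2,Y_1,Y_2}$ with finite alphabets $\mathcal U_1,\mathcal U_2$, with the given marginal $P_{Y_1,Y_2}$, that satisfy the Markov chain $U_1 - Y_1 - Y_2 - U_2$. Let $$\mathcal{RD}^{i}_{\mathrm{BT}}=\bigl\{(R_1,R_2,D_1,D_2)\in\mathbb R^4:\ \alpha D_1+(1-\alpha)D_2\ge D^{i}_{\mathrm{BT},\alpha}(R_1,R_2)\ \text{ for all }\alpha\in[0,1]\bigr\}.$$ Then $$\mathcal{RD}_{\mathrm{BT}}=\mathrm{conv}\bigl(\mathcal{RD}^{1}_{\mathrm{BT}}\cup\mathcal{RD}^{2}_{\mathrm{BT}}\bigr).$$ -/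

import Mathlib

noncomputable section

namespace LogLoss

section Information

variable {Ω A B C D : Type*} [Fintype Ω]

open scoped Classical in
/-- The pmf of the random variable `X : Ω → A`, where `Ω` is a finite sample space that carries
the pmf `P`. -/
def law (P : Ω → ℝ) (X : Ω → A) (a : A) : ℝ := ∑ ω with X ω = a, P ω

/-- The Shannon entropy `H(X) = -∑ p(x) log p(x)` (natural logarithm). -/
def entropy [Fintype A] (P : Ω → ℝ) (X : Ω → A) : ℝ :=
  -∑ a, law P X a * Real.log (law P X a)

/-- The conditional entropy `H(X|Z) = -∑ p(x,z) log p(x|z)`. -/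
def condEntropy [Fintype A] [Fintype C] (P : Ω → ℝ) (X : Ω → A) (Z : Ω → C) : ℝ :=
  -∑ a, ∑ c, law P (fun ω => (X ω, Z ω)) (a, c) *
    Real.log (law P (fun ω => (X ω, Z ω)) (a, c) / law P Z c)

/-- The mutual information `I(X;Y) = H(X) - H(X|Y)`. -/
def mutualInfo [Fintype A] [Fintype B] (P : Ω → ℝ) (X : Ω → A) (Y : Ω → B) : ℝ :=
  entropy P X - condEntropy P X Y

/-- The conditional mutual information `I(X;Y|Z) = H(X|Z) - H(X|Y,Z)`. -/
def condMutualInfo [Fintype A] [Fintype B] [Fintype C]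
    (P : Ω → ℝ) (X : Ω → A) (Y : Ω → B) (Z : Ω → C) : ℝ :=
  condEntropy P X Z - condEntropy P X (fun ω => (Y ω, Z ω))

/-- The Markov chain `X - Y - Z - W`, that is, `p(x,y,z,w) = p(y,z) p(x|y) p(w|z)`, with the
denominators `p(y)` and `p(z)` cleared. -/
def IsMarkovChain (P : Ω → ℝ) (X : Ω → A) (Y : Ω → B) (Z : Ω → C) (W : Ω → D) : Prop :=
  ∀ a b c d,
    law P (fun ω => (X ω, Y ω, Z ω, W ω)) (a, b, c, d) * law P Y b * law P Z c =
      law P (fun ω => (X ω, Y ω)) (a, b) * law P (fun ω => (Y ω, Z ω)) (b, c) *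
        law P (fun ω => (Z ω, W ω)) (c, d)

end Information

/-! The two sources, encoders and auxiliary variables are indexed by `Fin 2`; the index other
than `i` is `i + 1` (addition modulo 2). Source `i` has the finite alphabet `Y i`, and the pair of
sources has the joint pmf `p` on `∀ i, Y i`. A rate-distortion tuple `(R₁, R₂, D₁, D₂)` is a pair
`(R, D)` of functions on `Fin 2`. -/

section Regions

variable {Y : Fin 2 → Type*} [∀ i, Fintype (Y i)]

/-- The joint pmf `p(q) p(y₁,y₂) p(u₁|y₁,q) p(u₂|y₂,q)` of `(Q, (Y₁, Y₂), (U₁, U₂))`. -/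
def btJoint (p : (∀ i, Y i) → ℝ) {m : ℕ} {k : Fin 2 → ℕ} (pQ : Fin m → ℝ)
    (W : ∀ i, Y i → Fin m → Fin (k i) → ℝ) :
    Fin m × (∀ i, Y i) × (∀ i, Fin (k i)) → ℝ :=
  fun ω => pQ ω.1 * p ω.2.1 * ∏ i, W i (ω.2.1 i) ω.1 (ω.2.2 i)

/-- The rate-distortion region of the two-encoder multiterminal source coding problem under
logarithmic loss, in single-letter form. -/
def btRegion (p : (∀ i, Y i) → ℝ) : Set ((Fin 2 → ℝ) × (Fin 2 → ℝ)) :=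
  {x | ∃ (m : ℕ) (k : Fin 2 → ℕ) (pQ : Fin m → ℝ) (W : ∀ i, Y i → Fin m → Fin (k i) → ℝ),
    m ≤ 5 ∧ (∀ i, k i ≤ Fintype.card (Y i)) ∧
    pQ ∈ stdSimplex ℝ (Fin m) ∧ (∀ i y q, W i y q ∈ stdSimplex ℝ (Fin (k i))) ∧
    (∀ i, condMutualInfo (btJoint p pQ W) (fun ω => ω.2.2 i) (fun ω => ω.2.1 i)
      (fun ω => (ω.2.2 (i + 1), ω.1)) ≤ x.1 i) ∧
    condMutualInfo (btJoint p pQ W) (fun ω => ω.2.2) (fun ω => ω.2.1) (fun ω => ω.1)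
      ≤ x.1 0 + x.1 1 ∧
    (∀ i, condEntropy (btJoint p pQ W) (fun ω => ω.2.1 i) (fun ω => (ω.2.2, ω.1)) ≤ x.2 i)}

/-- `J` is a joint pmf of `((Y₁, Y₂), (U₁, U₂))` whose `(Y₁, Y₂)`-marginal is `p` and under which
`U₁ - Y₁ - Y₂ - U₂` is a Markov chain. -/
structure IsTestPmf (p : (∀ i, Y i) → ℝ) {k : Fin 2 → ℕ}
    (J : (∀ i, Y i) × (∀ i, Fin (k i)) → ℝ) : Prop where
  pmf : J ∈ stdSimplex ℝ ((∀ i, Y i) × (∀ i, Fin (k i)))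
  marginal : law J (fun ω => ω.1) = p
  markov : IsMarkovChain J (fun ω => ω.2 0) (fun ω => ω.1 0) (fun ω => ω.1 1) (fun ω => ω.2 1)

/-- The least value of `α H(Y₁|U₁,U₂) + (1 - α) H(Y₂|U₁,U₂)` over all test pmfs with arbitrary
finite auxiliary alphabets such that `I(Y_i;U_i|U_{iᶜ}) ≤ R_i` and `I(Y_{iᶜ};U_{iᶜ}) ≤ R_{iᶜ}`;
it is `⊤` if there is no such pmf. -/
def swzDistortion (p : (∀ i, Y i) → ℝ) (i : Fin 2) (α : ℝ) (R : Fin 2 → ℝ) : EReal :=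
  sInf {d : EReal | ∃ (k : Fin 2 → ℕ) (J : (∀ i, Y i) × (∀ i, Fin (k i)) → ℝ),
    IsTestPmf p J ∧
    condMutualInfo J (fun ω => ω.1 i) (fun ω => ω.2 i) (fun ω => ω.2 (i + 1)) ≤ R i ∧
    mutualInfo J (fun ω => ω.1 (i + 1)) (fun ω => ω.2 (i + 1)) ≤ R (i + 1) ∧
    d = ((α * condEntropy J (fun ω => ω.1 0) (fun ω => ω.2) +
      (1 - α) * condEntropy J (fun ω => ω.1 1) (fun ω => ω.2) : ℝ) : EReal)}

/-- The successive Wyner-Ziv region in which `U_{iᶜ}` is decoded first. -/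
def swzRegion (p : (∀ i, Y i) → ℝ) (i : Fin 2) : Set ((Fin 2 → ℝ) × (Fin 2 → ℝ)) :=
  {x | ∀ α ∈ Set.Icc (0 : ℝ) 1,
    swzDistortion p i α x.1 ≤ ((α * x.2 0 + (1 - α) * x.2 1 : ℝ) : EReal)}

end Regions

end LogLoss

end

/-! Every admissible joint pmf factors through a pair of test channels, so all the quantities become
combinations of entropies under `prodJoint`. A pair of channels has two corner points (`corner`),
one per decoding order, with equal distortions and equal sum rate. Every rate pair allowed by the
Berger-Tung inequalities lies coordinatewise above the segment joining these corners, and time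
sharing takes averages. This gives `btRegion_eq_upper_convexHull`: the region is the convex hull of
a compact set of corners plus the nonnegative orthant, the five values of `Q` being Carathéodory's
count in dimension four.

Shifted corners lie in the successive Wyner-Ziv regions, which yields one inclusion. For the other
(`swzRegion_subset`), a point of a successive region outside the closed convex Berger-Tung region is
strictly separated from it by a functional, whose coefficients are nonnegative because the region is
upward closed. Normalizing the distortion coefficients singles out an `α`, and a nearly optimal test
pmf for it has its corner on the wrong side of the separating hyperplane.

The alphabets of that pmf may be too large; `exists_channel_card_eq` repairs this. Reweighting the
output letters of one channel changes the functional linearly, since the nonlinear entropy terms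
cancel, so a basic solution of a linear program with one constraint per source letter does at least
as well. Only one functional has to be controlled, hence the sharp bound by the source alphabet. -/

noncomputable section
namespace LogLoss

/-! ### Laws and entropies on a finite sample space -/

section Entropy

variable {Ω A B C : Type*} [Fintype Ω]

theorem law_eq_sum_ite [DecidableEq A] (P : Ω → ℝ) (X : Ω → A) (a : A) :
    law P X a = ∑ ω, if X ω = a then P ω else 0 := by
  rw [law, Finset.sum_filter]
  exact Finset.sum_congr rfl fun ω _ => by congr

theorem law_nonneg {P : Ω → ℝ} (hP : ∀ ω, 0 ≤ P ω) (X : Ω → A) (a : A) : 0 ≤ law P X a :=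
  Finset.sum_nonneg fun ω _ => hP ω

theorem le_law {P : Ω → ℝ} (hP : ∀ ω, 0 ≤ P ω) (X : Ω → A) (ω : Ω) : P ω ≤ law P X (X ω) := by
  classical
  exact Finset.single_le_sum (f := P) (fun ω _ => hP ω) (by simp)

theorem sum_law_mul [Fintype A] (P : Ω → ℝ) (X : Ω → A) (f : A → ℝ) :
    ∑ a, law P X a * f a = ∑ ω, P ω * f (X ω) := by
  classical
  simp only [law_eq_sum_ite, Finset.sum_mul, ite_mul, zero_mul]
  rw [Finset.sum_comm]
  simp

theorem sum_law [Fintype A] (P : Ω → ℝ) (X : Ω → A) : ∑ a, law P X a = ∑ ω, P ω := by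
  simpa using sum_law_mul P X fun _ => 1

theorem law_congr_of_ne_zero (P : Ω → ℝ) {X : Ω → A} {X' : Ω → B}
    (h : ∀ ω ω', P ω ≠ 0 → P ω' ≠ 0 → (X ω = X ω' ↔ X' ω = X' ω')) {ω : Ω} (hω : P ω ≠ 0) :
    law P X (X ω) = law P X' (X' ω) := by
  classical
  simp only [law_eq_sum_ite]
  refine Finset.sum_congr rfl fun ω' _ => ?_
  by_cases h' : P ω' = 0
  · simp [h']
  · simp only [h ω' ω h' hω]

theorem law_congr (P : Ω → ℝ) {X : Ω → A} {X' : Ω → B}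
    (h : ∀ ω ω', X ω = X ω' ↔ X' ω = X' ω') (ω : Ω) :
    law P X (X ω) = law P X' (X' ω) := by
  classical
  simp only [law_eq_sum_ite, h]

theorem law_of_injective (P : Ω → ℝ) {X : Ω → A} (h : Function.Injective X) (ω : Ω) :
    law P X (X ω) = P ω := by
  classical
  simp [law_eq_sum_ite, h.eq_iff]

theorem law_law [Fintype A] (P : Ω → ℝ) (X : Ω → A) (f : A → B) :
    law (law P X) f = law P fun ω => f (X ω) := by
  classical
  ext b
  have := sum_law_mul P X fun a => if f a = b then 1 else 0
  simpa [law_eq_sum_ite _ f, law_eq_sum_ite P fun ω => f (X ω)] using this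

theorem law_mem_stdSimplex [Fintype A] {P : Ω → ℝ} (hP : P ∈ stdSimplex ℝ Ω) (X : Ω → A) :
    law P X ∈ stdSimplex ℝ A :=
  ⟨law_nonneg hP.1 X, (sum_law P X).trans hP.2⟩

theorem sum_law_pair [Fintype A] (P : Ω → ℝ) (X : Ω → A) (Z : Ω → C) (c : C) :
    ∑ a, law P (fun ω => (X ω, Z ω)) (a, c) = law P Z c := by
  classical
  simp only [law_eq_sum_ite, Prod.mk.injEq, ite_and]
  rw [Finset.sum_comm]
  simp

theorem entropy_eq_sum_negMulLog [Fintype A] (P : Ω → ℝ) (X : Ω → A) :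
    entropy P X = ∑ a, Real.negMulLog (law P X a) := by
  simp [entropy, Real.negMulLog, Finset.sum_neg_distrib]

theorem entropy_eq_sum [Fintype A] (P : Ω → ℝ) (X : Ω → A) :
    entropy P X = -∑ ω, P ω * Real.log (law P X (X ω)) := by
  rw [entropy, sum_law_mul P X fun a => Real.log (law P X a)]

/-- The entropy of a random variable depends only on the partition that it induces on the
support of the pmf. -/
theorem entropy_congr_of_ne_zero [Fintype A] [Fintype B] (P : Ω → ℝ) {X : Ω → A} {X' : Ω → B}
    (h : ∀ ω ω', P ω ≠ 0 → P ω' ≠ 0 → (X ω = X ω' ↔ X' ω = X' ω')) :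
    entropy P X = entropy P X' := by
  rw [entropy_eq_sum, entropy_eq_sum]
  refine congrArg _ (Finset.sum_congr rfl fun ω _ => ?_)
  by_cases hω : P ω = 0
  · simp [hω]
  · rw [law_congr_of_ne_zero P h hω]

theorem entropy_congr [Fintype A] [Fintype B] (P : Ω → ℝ) {X : Ω → A} {X' : Ω → B}
    (h : ∀ ω ω', X ω = X ω' ↔ X' ω = X' ω') : entropy P X = entropy P X' :=
  entropy_congr_of_ne_zero P fun ω ω' _ _ => h ω ω'

theorem entropy_law_of_ne_zero [Fintype A] [Fintype B] [Fintype C] (P : Ω → ℝ) (Φ : Ω → A)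
    (X : A → B) (X' : Ω → C)
    (h : ∀ ω ω', P ω ≠ 0 → P ω' ≠ 0 → (X (Φ ω) = X (Φ ω') ↔ X' ω = X' ω')) :
    entropy (law P Φ) X = entropy P X' := by
  rw [← entropy_congr_of_ne_zero P h, entropy, entropy, law_law]

theorem condEntropy_eq_sum [Fintype A] [Fintype C] (P : Ω → ℝ) (X : Ω → A) (Z : Ω → C) :
    condEntropy P X Z =
      -∑ ω, P ω * Real.log (law P (fun ω => (X ω, Z ω)) (X ω, Z ω) / law P Z (Z ω)) := by
  rw [condEntropy, ← Fintype.sum_prod_type' (f := fun a c =>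
    law P (fun ω => (X ω, Z ω)) (a, c) *
      Real.log (law P (fun ω => (X ω, Z ω)) (a, c) / law P Z c))]
  rw [sum_law_mul P (fun ω => (X ω, Z ω)) fun x =>
    Real.log (law P (fun ω => (X ω, Z ω)) (x.1, x.2) / law P Z x.2)]

theorem condEntropy_congr_right [Fintype A] [Fintype B] [Fintype C] (P : Ω → ℝ) (X : Ω → A)
    {Z : Ω → B} {Z' : Ω → C} (h : ∀ ω ω', Z ω = Z ω' ↔ Z' ω = Z' ω') :
    condEntropy P X Z = condEntropy P X Z' := by
  have h' : ∀ ω ω', (X ω, Z ω) = (X ω', Z ω') ↔ (X ω, Z' ω) = (X ω', Z' ω') := by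
    simp [h]
  have := law_congr P h'
  simp only [condEntropy_eq_sum, law_congr P h, this]

theorem condEntropy_eq_sub [Fintype A] [Fintype C] {P : Ω → ℝ} (hP : ∀ ω, 0 ≤ P ω)
    (X : Ω → A) (Z : Ω → C) :
    condEntropy P X Z = entropy P (fun ω => (X ω, Z ω)) - entropy P Z := by
  rw [condEntropy_eq_sum, entropy_eq_sum, entropy_eq_sum, neg_sub_neg, ← Finset.sum_sub_distrib,
    ← Finset.sum_neg_distrib]
  refine Finset.sum_congr rfl fun ω _ => ?_
  rcases (hP ω).eq_or_lt with h | h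
  · simp [← h]
  · rw [Real.log_div (h.trans_le (le_law hP (fun ω => (X ω, Z ω)) ω)).ne'
      (h.trans_le (le_law hP Z ω)).ne']
    ring

/-- The chain rule: `negMulLog` of a product splits in two, and the rows of `w` sum to one. -/
theorem entropy_prod_of_channel [Fintype A] [Fintype C] (P : Ω → ℝ) (X : Ω → A) (Z : Ω → C)
    (w : C → A → ℝ) (hw : ∀ c, ∑ a, w c a = 1)
    (h : ∀ a c, law P (fun ω => (X ω, Z ω)) (a, c) = law P Z c * w c a) :
    entropy P (fun ω => (X ω, Z ω)) =
      entropy P Z + ∑ ω, P ω * ∑ a, Real.negMulLog (w (Z ω) a) := by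
  rw [← sum_law_mul P Z fun c => ∑ a, Real.negMulLog (w c a), entropy_eq_sum_negMulLog,
    entropy_eq_sum_negMulLog, Fintype.sum_prod_type_right, ← Finset.sum_add_distrib]
  refine Finset.sum_congr rfl fun c _ => ?_
  simp only [h, Real.negMulLog_mul, Finset.sum_add_distrib, ← Finset.sum_mul, hw, one_mul,
    ← Finset.mul_sum]

/-- Average `log t ≤ t - 1` at `t` the ratio of the product of the marginals to the joint law. -/
theorem entropy_prod_le [Fintype A] [Fintype B] {P : Ω → ℝ} (hP : P ∈ stdSimplex ℝ Ω)
    (X : Ω → A) (Z : Ω → B) :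
    entropy P (fun ω => (X ω, Z ω)) ≤ entropy P X + entropy P Z := by
  set L : A × B → ℝ := law P (fun ω => (X ω, Z ω)) with hL
  -- Only an inequality: pairs of joint probability zero are lost on the left but may have positive
  -- product probability.
  have key : ∑ ω, P ω * (law P X (X ω) * law P Z (Z ω) / L (X ω, Z ω)) ≤ 1 := by
    rw [← sum_law_mul P (fun ω => (X ω, Z ω)) fun x => law P X x.1 * law P Z x.2 / L x]
    calc _ ≤ ∑ x : A × B, law P X x.1 * law P Z x.2 := by
          refine Finset.sum_le_sum fun x _ => ?_
          have h0 : 0 ≤ law P X x.1 * law P Z x.2 :=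
            mul_nonneg (law_nonneg hP.1 _ _) (law_nonneg hP.1 _ _)
          by_cases hx : L x = 0
          · simpa [← hL, hx] using h0
          · rw [← hL, mul_div_cancel₀ _ hx]
      _ = 1 := by
          rw [Fintype.sum_prod_type]
          simp only [← Finset.mul_sum, sum_law, hP.2, mul_one]
  have hpt : ∀ ω, P ω * Real.log (law P X (X ω)) + P ω * Real.log (law P Z (Z ω))
      - P ω * Real.log (L (X ω, Z ω))
      ≤ P ω * (law P X (X ω) * law P Z (Z ω) / L (X ω, Z ω)) - P ω := by
    intro ω
    rcases (hP.1 ω).eq_or_lt with h | h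
    · simp [← h]
    · have hx := h.trans_le (le_law hP.1 X ω)
      have hz := h.trans_le (le_law hP.1 Z ω)
      have hl : 0 < L (X ω, Z ω) := h.trans_le (le_law hP.1 (fun ω => (X ω, Z ω)) ω)
      have := Real.log_le_sub_one_of_pos (div_pos (mul_pos hx hz) hl)
      rw [Real.log_div (mul_pos hx hz).ne' hl.ne', Real.log_mul hx.ne' hz.ne'] at this
      nlinarith [mul_le_mul_of_nonneg_left this h.le]
  have hs := Finset.sum_le_sum fun ω (_ : ω ∈ Finset.univ) => hpt ω
  simp only [Finset.sum_sub_distrib, Finset.sum_add_distrib, hP.2] at hs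
  rw [entropy_eq_sum, entropy_eq_sum, entropy_eq_sum]
  linarith

/-- Conditioning on a time-sharing variable `Q` averages the conditional entropies. -/
theorem condEntropy_time_sharing {Q : Type*} [Fintype Q] [Fintype A] [Fintype C]
    (pQ : Q → ℝ) (P : Q → Ω → ℝ) (X : Ω → A) (Z : Ω → C) :
    condEntropy (fun ω : Q × Ω => pQ ω.1 * P ω.1 ω.2) (fun ω => X ω.2)
      (fun ω => (Z ω.2, ω.1)) = ∑ q, pQ q * condEntropy (P q) X Z := by
  classical
  have h1 : ∀ a c q, law (fun ω : Q × Ω => pQ ω.1 * P ω.1 ω.2)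
      (fun ω => (X ω.2, (Z ω.2, ω.1))) (a, (c, q)) =
      pQ q * law (P q) (fun ω => (X ω, Z ω)) (a, c) := by
    intro a c q
    simp only [law_eq_sum_ite, Fintype.sum_prod_type, Finset.mul_sum, Prod.mk.injEq, mul_ite,
      mul_zero]
    rw [Finset.sum_eq_single q]
    · simp
    · intro b _ hb; simp [hb]
    · simp
  have h2 : ∀ c q, law (fun ω : Q × Ω => pQ ω.1 * P ω.1 ω.2)
      (fun ω => (Z ω.2, ω.1)) (c, q) = pQ q * law (P q) Z c := by
    intro c q
    simp only [law_eq_sum_ite, Fintype.sum_prod_type, Finset.mul_sum, Prod.mk.injEq, mul_ite,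
      mul_zero]
    rw [Finset.sum_eq_single q]
    · simp
    · intro b _ hb; simp [hb]
    · simp
  simp only [condEntropy, Fintype.sum_prod_type, h1, h2, mul_neg, Finset.sum_neg_distrib,
    Finset.mul_sum]
  congr 1
  rw [Finset.sum_comm (s := (Finset.univ : Finset Q))]
  refine Finset.sum_congr rfl fun a _ => ?_
  rw [Finset.sum_comm (s := (Finset.univ : Finset Q))]
  refine Finset.sum_congr rfl fun c _ => Finset.sum_congr rfl fun q _ => ?_
  by_cases hq : pQ q = 0
  · simp [hq]
  · rw [mul_div_mul_left _ _ hq, mul_assoc]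

end Entropy
-- Information quantities of a pair of independent test channels
section ProductChannel

theorem pi_two_ext {α : Fin 2 → Type*} (i : Fin 2) {u v : ∀ j, α j} :
    u = v ↔ u i = v i ∧ u (i + 1) = v (i + 1) := by
  refine ⟨fun h => h ▸ ⟨rfl, rfl⟩, fun ⟨h, h'⟩ => funext fun j => ?_⟩
  have : ∀ i j : Fin 2, j = i ∨ j = i + 1 := by decide
  rcases this i j with rfl | rfl <;> assumption

theorem bijective_eval_two {α : Fin 2 → Type*} (i : Fin 2) :
    Function.Bijective fun u : ∀ j, α j => (u i, u (i + 1)) := by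
  refine ⟨fun u v h => (pi_two_ext i).2 (Prod.mk.inj h), ?_⟩
  revert i
  refine Fin.forall_fin_two.2 ⟨fun x => ?_, fun x => ?_⟩
  · exact ⟨(piFinTwoEquiv α).symm x, (piFinTwoEquiv α).apply_symm_apply x⟩
  · exact ⟨(piFinTwoEquiv α).symm x.swap,
      congrArg Prod.swap ((piFinTwoEquiv α).apply_symm_apply x.swap)⟩

theorem sum_pi_two {α : Fin 2 → Type*} [∀ i, Fintype (α i)] (i : Fin 2)
    (F : α i → α (i + 1) → ℝ) :
    ∑ u : ∀ j, α j, F (u i) (u (i + 1)) = ∑ a, ∑ b, F a b := by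
  rw [← Fintype.sum_prod_type']
  exact Fintype.sum_bijective _ (bijective_eval_two i) _ _ fun u => rfl

theorem prod_fin_two (i : Fin 2) (f : Fin 2 → ℝ) : ∏ j, f j = f i * f (i + 1) := by
  revert i
  refine Fin.forall_fin_two.2 ⟨?_, ?_⟩
  · simp [Fin.prod_univ_two]
  · simp [Fin.prod_univ_two, mul_comm]

variable {Y : Fin 2 → Type*} {k : Fin 2 → ℕ}

/-- The joint pmf `p(y₁,y₂) p(u₁|y₁) p(u₂|y₂)`. -/
def prodJoint (p : (∀ i, Y i) → ℝ) (W : ∀ i, Y i → Fin (k i) → ℝ) :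
    (∀ i, Y i) × (∀ i, Fin (k i)) → ℝ :=
  fun ω => p ω.1 * ∏ i, W i (ω.1 i) (ω.2 i)

/-- `W i` is a channel from `Y i` to `Fin (k i)` for each `i`. -/
def IsChannel (W : ∀ i, Y i → Fin (k i) → ℝ) : Prop :=
  ∀ i y, W i y ∈ stdSimplex ℝ (Fin (k i))

theorem IsChannel.prod_nonneg {W : ∀ i, Y i → Fin (k i) → ℝ} (hW : IsChannel W)
    (y : ∀ i, Y i) (u : ∀ i, Fin (k i)) : 0 ≤ ∏ i, W i (y i) (u i) :=
  Finset.prod_nonneg fun i _ => (hW i (y i)).1 (u i)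

theorem IsChannel.sum_prod {W : ∀ i, Y i → Fin (k i) → ℝ} (hW : IsChannel W)
    (y : ∀ i, Y i) : ∑ u : ∀ i, Fin (k i), ∏ i, W i (y i) (u i) = 1 := by
  have := Finset.prod_univ_sum (fun i => (Finset.univ : Finset (Fin (k i))))
    (fun i u => W i (y i) u)
  rw [Fintype.piFinset_univ] at this
  rw [← this]
  exact Finset.prod_eq_one fun i _ => (hW i (y i)).2

variable [∀ i, Fintype (Y i)] {p : (∀ i, Y i) → ℝ} {W : ∀ i, Y i → Fin (k i) → ℝ}

theorem sum_prodJoint_mul (hW : IsChannel W) (G : (∀ i, Y i) → ℝ) :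
    ∑ ω, prodJoint p W ω * G ω.1 = ∑ y, p y * G y := by
  rw [Fintype.sum_prod_type]
  refine Finset.sum_congr rfl fun y _ => ?_
  simp only [prodJoint, ← Finset.sum_mul, ← Finset.mul_sum, hW.sum_prod, mul_one]

theorem prodJoint_mem_stdSimplex (hp : p ∈ stdSimplex ℝ (∀ i, Y i)) (hW : IsChannel W) :
    prodJoint p W ∈ stdSimplex ℝ ((∀ i, Y i) × (∀ i, Fin (k i))) := by
  refine ⟨fun ω => mul_nonneg (hp.1 _) (hW.prod_nonneg _ _), ?_⟩
  simpa [hp.2] using sum_prodJoint_mul (p := p) hW fun _ => 1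

/-- Conditionally on everything but `U i`, the law of `U i` is `W i (Y i)`. -/
theorem sum_prodJoint_ite (hW : IsChannel W) (i : Fin 2) (u : Fin (k i))
    (F : (∀ i, Y i) → Fin (k (i + 1)) → ℝ) :
    ∑ ω, prodJoint p W ω * (if ω.2 i = u then F ω.1 (ω.2 (i + 1)) else 0) =
      ∑ ω, prodJoint p W ω * (W i (ω.1 i) u * F ω.1 (ω.2 (i + 1))) := by
  rw [Fintype.sum_prod_type, Fintype.sum_prod_type]
  refine Finset.sum_congr rfl fun y _ => ?_
  simp only [prodJoint]
  simp only [fun v : ∀ i, Fin (k i) => prod_fin_two i fun j => W j (y j) (v j)]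
  refine (sum_pi_two (α := fun i => Fin (k i)) i fun a b =>
    p y * (W i (y i) a * W (i + 1) (y (i + 1)) b) *
    (if a = u then F y b else 0)).trans (Eq.trans ?_ (sum_pi_two
      (α := fun i => Fin (k i)) i fun a b =>
      p y * (W i (y i) a * W (i + 1) (y (i + 1)) b) * (W i (y i) u * F y b)).symm)
  rw [Finset.sum_comm, Finset.sum_comm (s := Finset.univ (α := Fin (k i)))]
  refine Finset.sum_congr rfl fun b _ => ?_
  simp only [mul_ite, mul_zero, Finset.sum_ite_eq', Finset.mem_univ, if_true]
  calc _ = (∑ a, W i (y i) a) *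
        (p y * W (i + 1) (y (i + 1)) b * (W i (y i) u * F y b)) := by
        rw [(hW i (y i)).2]; ring
    _ = _ := by
        rw [Finset.sum_mul]
        exact Finset.sum_congr rfl fun a _ => by ring

theorem law_prodJoint_pair {C : Type*} [DecidableEq C] (hW : IsChannel W) (i : Fin 2)
    (Z : (∀ i, Y i) → Fin (k (i + 1)) → C) (u : Fin (k i)) (c : C) :
    law (prodJoint p W) (fun ω => (ω.2 i, Z ω.1 (ω.2 (i + 1)))) (u, c) =
      ∑ ω, prodJoint p W ω * (W i (ω.1 i) u * if Z ω.1 (ω.2 (i + 1)) = c then 1 else 0) := by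
  rw [← sum_prodJoint_ite hW i u fun y t => if Z y t = c then 1 else 0, law_eq_sum_ite]
  refine Finset.sum_congr rfl fun ω _ => ?_
  by_cases h : ω.2 i = u <;> simp [h]

/-- Given the sources and the other auxiliary variable, `U_i` depends on `Y_i` alone; as `Z` reveals
`Y_i` through `π`, the channel factor is constant on each fibre of `Z`. -/
theorem law_prodJoint_pair_of_determined {C : Type*} (hW : IsChannel W) (i : Fin 2)
    (Z : (∀ i, Y i) → Fin (k (i + 1)) → C) (π : C → Y i) (hπ : ∀ y t, π (Z y t) = y i)
    (u : Fin (k i)) (c : C) :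
    law (prodJoint p W) (fun ω => (ω.2 i, Z ω.1 (ω.2 (i + 1)))) (u, c) =
      law (prodJoint p W) (fun ω => Z ω.1 (ω.2 (i + 1))) c * W i (π c) u := by
  classical
  rw [law_prodJoint_pair hW, law_eq_sum_ite, Finset.sum_mul]
  refine Finset.sum_congr rfl fun ω _ => ?_
  by_cases h : Z ω.1 (ω.2 (i + 1)) = c
  · simp [← h, hπ]
  · simp [h]

theorem law_prodJoint_source (hW : IsChannel W) : law (prodJoint p W) (fun ω => ω.1) = p := by
  classical
  ext y
  have := sum_prodJoint_mul (p := p) hW fun y' => if y' = y then 1 else 0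
  simpa [law_eq_sum_ite] using this

theorem law_prodJoint_aux_one (hW : IsChannel W) (i : Fin 2) (u : Fin (k i)) :
    law (prodJoint p W) (fun ω => ω.2 i) u = ∑ y, p y * W i (y i) u := by
  classical
  rw [← sum_prodJoint_mul hW fun y => W i (y i) u]
  have := sum_prodJoint_ite (p := p) hW i u fun _ _ => 1
  simpa [law_eq_sum_ite] using this

/-- The conditional entropy `H(U_i|Y_i)`. -/
def channelEntropy (p : (∀ i, Y i) → ℝ) (W : ∀ i, Y i → Fin (k i) → ℝ) (i : Fin 2) : ℝ :=
  ∑ y, p y * ∑ u, Real.negMulLog (W i (y i) u)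

/-- The entropy `H(U_i)`. -/
def auxEntropy (p : (∀ i, Y i) → ℝ) (W : ∀ i, Y i → Fin (k i) → ℝ) (i : Fin 2) : ℝ :=
  entropy (prodJoint p W) (fun ω => ω.2 i)

/-- The mutual information `I(Y_i;U_i)`. -/
def firstRate (p : (∀ i, Y i) → ℝ) (W : ∀ i, Y i → Fin (k i) → ℝ) (i : Fin 2) : ℝ :=
  auxEntropy p W i - channelEntropy p W i

/-- The conditional mutual information `I(Y_i;U_i|U_{iᶜ})`. -/
def secondRate (p : (∀ i, Y i) → ℝ) (W : ∀ i, Y i → Fin (k i) → ℝ) (i : Fin 2) : ℝ :=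
  entropy (prodJoint p W) (fun ω => ω.2) - auxEntropy p W (i + 1) - channelEntropy p W i

/-- The conditional entropy `H(Y_i|U₁,U₂)`. -/
def distortion (p : (∀ i, Y i) → ℝ) (W : ∀ i, Y i → Fin (k i) → ℝ) (i : Fin 2) : ℝ :=
  entropy (prodJoint p W) (fun ω => (ω.1 i, ω.2)) - entropy (prodJoint p W) (fun ω => ω.2)

/-- The entropy of `(U_i, Z)` if `Z` determines `Y_i` and does not involve `U_i`. -/
theorem entropy_aux_pair {C : Type*} [Fintype C] (hW : IsChannel W) (i : Fin 2)
    (Z : (∀ i, Y i) → Fin (k (i + 1)) → C) (π : C → Y i) (hπ : ∀ y t, π (Z y t) = y i) :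
    entropy (prodJoint p W) (fun ω => (ω.2 i, Z ω.1 (ω.2 (i + 1)))) =
      entropy (prodJoint p W) (fun ω => Z ω.1 (ω.2 (i + 1))) + channelEntropy p W i := by
  rw [entropy_prod_of_channel (prodJoint p W) (fun ω => ω.2 i) (fun ω => Z ω.1 (ω.2 (i + 1)))
    (fun c => W i (π c)) (fun c => (hW i _).2)
    (fun u c => law_prodJoint_pair_of_determined hW i Z π hπ u c)]
  simp only [hπ]
  rw [sum_prodJoint_mul hW fun y => ∑ u, Real.negMulLog (W i (y i) u), channelEntropy]

theorem entropy_aux_source (hW : IsChannel W) :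
    entropy (prodJoint p W) (fun ω => (ω.2, ω.1)) =
      entropy (prodJoint p W) (fun ω => ω.1) + channelEntropy p W 0 + channelEntropy p W 1 := by
  have h0 := entropy_aux_pair (p := p) hW 0 (fun y t => (t, y)) (fun c => c.2 0) fun _ _ => rfl
  have h1 := entropy_aux_pair (p := p) hW 1 (fun y _ => y) (fun c => c 1) fun _ _ => rfl
  have : entropy (prodJoint p W) (fun ω => (ω.2, ω.1)) =
      entropy (prodJoint p W) (fun ω => (ω.2 0, (ω.2 1, ω.1))) :=
    entropy_congr _ fun ω ω' => by
      simp only [Prod.mk.injEq]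
      rw [pi_two_ext 0, and_assoc]; rfl
  rw [this]
  refine h0.trans ?_
  rw [add_right_comm]
  exact congrArg (· + _) h1

theorem condMutualInfo_aux_source (hp : p ∈ stdSimplex ℝ (∀ i, Y i))
    (hW : IsChannel W) (i : Fin 2) :
    condMutualInfo (prodJoint p W) (fun ω => ω.2 i) (fun ω => ω.1 i) (fun ω => ω.2 (i + 1)) =
      secondRate p W i := by
  have hP := (prodJoint_mem_stdSimplex hp hW).1
  have h : entropy (prodJoint p W) (fun ω => (ω.2 i, ω.2 (i + 1))) =
      entropy (prodJoint p W) (fun ω => ω.2) :=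
    entropy_congr _ fun ω ω' => by rw [Prod.mk.injEq, pi_two_ext i]
  rw [condMutualInfo, condEntropy_eq_sub hP, condEntropy_eq_sub hP, secondRate, auxEntropy, h,
    entropy_aux_pair hW i (fun y t => (y i, t)) (fun c => c.1) fun _ _ => rfl]
  ring

theorem condMutualInfo_source_aux (hp : p ∈ stdSimplex ℝ (∀ i, Y i))
    (hW : IsChannel W) (i : Fin 2) :
    condMutualInfo (prodJoint p W) (fun ω => ω.1 i) (fun ω => ω.2 i) (fun ω => ω.2 (i + 1)) =
      secondRate p W i := by
  have hP := (prodJoint_mem_stdSimplex hp hW).1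
  have h : entropy (prodJoint p W) (fun ω => (ω.2 i, ω.2 (i + 1))) =
      entropy (prodJoint p W) (fun ω => ω.2) :=
    entropy_congr _ fun ω ω' => by rw [Prod.mk.injEq, pi_two_ext i]
  have h' : entropy (prodJoint p W) (fun ω => (ω.1 i, (ω.2 i, ω.2 (i + 1)))) =
      entropy (prodJoint p W) (fun ω => (ω.2 i, (ω.1 i, ω.2 (i + 1)))) :=
    entropy_congr _ fun ω ω' => by simp only [Prod.mk.injEq]; tauto
  rw [condMutualInfo, condEntropy_eq_sub hP, condEntropy_eq_sub hP, secondRate, auxEntropy, h, h',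
    entropy_aux_pair hW i (fun y t => (y i, t)) (fun c => c.1) fun _ _ => rfl]
  ring

theorem mutualInfo_source_aux (hp : p ∈ stdSimplex ℝ (∀ i, Y i))
    (hW : IsChannel W) (i : Fin 2) :
    mutualInfo (prodJoint p W) (fun ω => ω.1 i) (fun ω => ω.2 i) = firstRate p W i := by
  have hP := (prodJoint_mem_stdSimplex hp hW).1
  have h : entropy (prodJoint p W) (fun ω => (ω.1 i, ω.2 i)) =
      entropy (prodJoint p W) (fun ω => (ω.2 i, ω.1 i)) :=
    entropy_congr _ fun ω ω' => by simp only [Prod.mk.injEq]; tauto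
  rw [mutualInfo, condEntropy_eq_sub hP, firstRate, auxEntropy, h,
    entropy_aux_pair hW i (fun y _ => y i) (fun c => c) fun _ _ => rfl]
  ring

theorem condEntropy_source_aux (hp : p ∈ stdSimplex ℝ (∀ i, Y i))
    (hW : IsChannel W) (i : Fin 2) :
    condEntropy (prodJoint p W) (fun ω => ω.1 i) (fun ω => ω.2) = distortion p W i :=
  condEntropy_eq_sub (prodJoint_mem_stdSimplex hp hW).1 _ _

/-- Both sides equal `H(U₁,U₂) - H(U₁|Y₁) - H(U₂|Y₂)`. The trivial conditioning variable matches the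
form that remains once time sharing is averaged out. -/
theorem condMutualInfo_aux_source_unit (hp : p ∈ stdSimplex ℝ (∀ i, Y i))
    (hW : IsChannel W) :
    condMutualInfo (prodJoint p W) (fun ω => ω.2) (fun ω => ω.1) (fun _ => ()) =
      secondRate p W 0 + firstRate p W 1 := by
  have hP := (prodJoint_mem_stdSimplex hp hW).1
  have h1 : entropy (prodJoint p W) (fun ω => (ω.2, ())) =
      entropy (prodJoint p W) (fun ω => ω.2) := entropy_congr _ fun ω ω' => by simp
  have h2 : entropy (prodJoint p W) (fun ω => (ω.2, (ω.1, ()))) =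
      entropy (prodJoint p W) (fun ω => (ω.2, ω.1)) := entropy_congr _ fun ω ω' => by simp
  have h3 : entropy (prodJoint p W) (fun ω => (ω.1, ())) =
      entropy (prodJoint p W) (fun ω => ω.1) := entropy_congr _ fun ω ω' => by simp
  have h4 : entropy (prodJoint p W) (fun _ => ()) = 0 := by
    rw [entropy_eq_sum]
    simp [law_eq_sum_ite, (prodJoint_mem_stdSimplex hp hW).2]
  rw [condMutualInfo, condEntropy_eq_sub hP, condEntropy_eq_sub hP, h1, h2, h3, h4,
    entropy_aux_source hW, secondRate, firstRate, show (0 : Fin 2) + 1 = 1 from rfl]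
  ring

/-- The sum rate does not depend on the decoding order, since the entropy of the auxiliary variable
decoded first cancels. -/
theorem secondRate_add_firstRate (i : Fin 2) :
    secondRate p W i + firstRate p W (i + 1) = secondRate p W 0 + firstRate p W 1 := by
  revert i
  refine Fin.forall_fin_two.2 ⟨rfl, ?_⟩
  rw [secondRate, firstRate, secondRate, firstRate, show (1 : Fin 2) + 1 = 0 from rfl,
    show (0 : Fin 2) + 1 = 1 from rfl]
  ring

/-- The gap is `I(U_i;U_{iᶜ})`, nonnegative by subadditivity of entropy. -/
theorem secondRate_le_firstRate (hp : p ∈ stdSimplex ℝ (∀ i, Y i))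
    (hW : IsChannel W) (i : Fin 2) : secondRate p W i ≤ firstRate p W i := by
  have h : entropy (prodJoint p W) (fun ω => (ω.2 i, ω.2 (i + 1))) =
      entropy (prodJoint p W) (fun ω => ω.2) :=
    entropy_congr _ fun ω ω' => by rw [Prod.mk.injEq, pi_two_ext i]
  have := entropy_prod_le (prodJoint_mem_stdSimplex hp hW) (fun ω => ω.2 i)
    (fun ω => ω.2 (i + 1))
  rw [h] at this
  rw [secondRate, firstRate, auxEntropy, auxEntropy]
  linarith

end ProductChannel
-- Test pmfs are exactly the products of channels
section TestPmf

variable {Y : Fin 2 → Type*} [∀ i, Fintype (Y i)] {k : Fin 2 → ℕ} {p : (∀ i, Y i) → ℝ}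

theorem isTestPmf_prodJoint {W : ∀ i, Y i → Fin (k i) → ℝ} (hp : p ∈ stdSimplex ℝ (∀ i, Y i))
    (hW : IsChannel W) : IsTestPmf p (prodJoint p W) := by
  refine ⟨prodJoint_mem_stdSimplex hp hW, law_prodJoint_source hW, ?_⟩
  intro a b c d
  obtain ⟨y, hy⟩ := (bijective_eval_two (α := Y) 0).2 (b, c)
  obtain ⟨u, hu⟩ := (bijective_eval_two (α := fun i => Fin (k i)) 0).2 (a, d)
  obtain ⟨rfl, rfl⟩ : y 0 = b ∧ y 1 = c := Prod.mk.inj hy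
  obtain ⟨rfl, rfl⟩ : u 0 = a ∧ u 1 = d := Prod.mk.inj hu
  have e1 : law (prodJoint p W) (fun ω => (ω.2 0, ω.1 0, ω.1 1, ω.2 1))
      (u 0, y 0, y 1, u 1) = prodJoint p W (y, u) :=
    law_of_injective (prodJoint p W) (X := fun ω => (ω.2 0, ω.1 0, ω.1 1, ω.2 1))
      (fun ω ω' h => by
        simp only [Prod.mk.injEq] at h
        exact Prod.ext ((pi_two_ext 0).2 ⟨h.2.1, h.2.2.1⟩) ((pi_two_ext 0).2 ⟨h.1, h.2.2.2⟩))
      (y, u)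
  have e2 : law (prodJoint p W) (fun ω => (ω.1 0, ω.1 1)) (y 0, y 1) = p y := by
    conv_rhs => rw [← law_prodJoint_source (p := p) hW]
    exact law_congr (prodJoint p W) (X := fun ω => (ω.1 0, ω.1 1)) (X' := fun ω => ω.1)
      (fun ω ω' => by rw [Prod.mk.injEq, pi_two_ext 0]; rfl) (y, u)
  have e3 := law_prodJoint_pair_of_determined (p := p) hW 0 (fun y _ => y 0) (fun c => c)
    (fun _ _ => rfl) (u 0) (y 0)
  have e4 := law_prodJoint_pair_of_determined (p := p) hW 1 (fun y _ => y 1) (fun c => c)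
    (fun _ _ => rfl) (u 1) (y 1)
  have e5 : law (prodJoint p W) (fun ω => (ω.1 1, ω.2 1)) (y 1, u 1) =
      law (prodJoint p W) (fun ω => (ω.2 1, ω.1 1)) (u 1, y 1) :=
    law_congr (prodJoint p W) (X := fun ω => (ω.1 1, ω.2 1)) (X' := fun ω => (ω.2 1, ω.1 1))
      (fun ω ω' => by simp only [Prod.mk.injEq]; tauto) (y, u)
  refine (congrArg (· * _ * _) e1).trans ?_
  refine Eq.trans ?_ (congrArg₂ (· * ·) (congrArg₂ (· * ·) e3 e2) (e5.trans e4)).symm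
  simp only [prodJoint, Fin.prod_univ_two]
  ring

theorem IsTestPmf.exists_channel {J : (∀ i, Y i) × (∀ i, Fin (k i)) → ℝ} (hJ : IsTestPmf p J) :
    ∃ W : ∀ i, Y i → Fin (k i) → ℝ, IsChannel W ∧ prodJoint p W = J := by
  classical
  have hJ0 := hJ.pmf.1
  -- For a source letter of probability zero the conditional law is replaced by the marginal of
  -- `U_i`, which is a pmf in any case.
  refine ⟨fun i y u => if law J (fun ω => ω.1 i) y = 0 then law J (fun ω => ω.2 i) u else
    law J (fun ω => (ω.2 i, ω.1 i)) (u, y) / law J (fun ω => ω.1 i) y, fun i y => ?_, ?_⟩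
  · by_cases h : law J (fun ω => ω.1 i) y = 0
    · simp only [h, if_true]
      exact law_mem_stdSimplex hJ.pmf _
    · simp only [h, if_false]
      refine ⟨fun u => div_nonneg (law_nonneg hJ0 _ _) (law_nonneg hJ0 _ _), ?_⟩
      rw [← Finset.sum_div, sum_law_pair J (fun ω => ω.2 i) (fun ω => ω.1 i), div_self h]
  · ext ⟨y, u⟩
    -- At null source letters both `p` and `J` vanish, so the default rows have no effect.
    have hzero : ∀ i, law J (fun ω => ω.1 i) (y i) = 0 → p y = 0 ∧ J (y, u) = 0 := by
      intro i hi
      have h0 : ∀ v, J (y, v) = 0 := fun v =>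
        le_antisymm ((le_law hJ0 (fun ω => ω.1 i) (y, v)).trans hi.le) (hJ0 _)
      refine ⟨?_, h0 u⟩
      rw [← hJ.marginal]
      simp [law_eq_sum_ite, Fintype.sum_prod_type, Finset.sum_comm (s := (Finset.univ :
        Finset (∀ i, Y i))), h0]
    by_cases h0 : law J (fun ω => ω.1 0) (y 0) = 0
    · simp [prodJoint, hzero 0 h0]
    by_cases h1 : law J (fun ω => ω.1 1) (y 1) = 0
    · simp [prodJoint, hzero 1 h1]
    have hm := hJ.markov (u 0) (y 0) (y 1) (u 1)
    have e1 : law J (fun ω => (ω.2 0, ω.1 0, ω.1 1, ω.2 1)) (u 0, y 0, y 1, u 1) = J (y, u) :=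
      law_of_injective J (X := fun ω => (ω.2 0, ω.1 0, ω.1 1, ω.2 1))
        (fun ω ω' h => by
          simp only [Prod.mk.injEq] at h
          exact Prod.ext ((pi_two_ext 0).2 ⟨h.2.1, h.2.2.1⟩) ((pi_two_ext 0).2 ⟨h.1, h.2.2.2⟩))
        (y, u)
    have e2 : law J (fun ω => (ω.1 0, ω.1 1)) (y 0, y 1) = p y := by
      conv_rhs => rw [← hJ.marginal]
      exact law_congr J (X := fun ω => (ω.1 0, ω.1 1)) (X' := fun ω => ω.1)
        (fun ω ω' => by rw [Prod.mk.injEq, pi_two_ext 0]; rfl) (y, u)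
    have e5 : law J (fun ω => (ω.1 1, ω.2 1)) (y 1, u 1) =
        law J (fun ω => (ω.2 1, ω.1 1)) (u 1, y 1) :=
      law_congr J (X := fun ω => (ω.1 1, ω.2 1)) (X' := fun ω => (ω.2 1, ω.1 1))
        (fun ω ω' => by simp only [Prod.mk.injEq]; tauto) (y, u)
    rw [e1, e2, e5] at hm
    simp only [prodJoint, Fin.prod_univ_two, h0, h1, if_false]
    field_simp
    linarith

end TestPmf

/-! ### Basic solutions of linear programs -/

section LinearProgram

/-- A basic feasible solution of a linear program has small support. -/
theorem exists_small_support {K E : Type*} [Fintype K] [Fintype E] (w : K → E → ℝ) (g c₀ : K → ℝ)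
    (hw : ∀ u e, 0 ≤ w u e) (hc₀ : ∀ u, 0 ≤ c₀ u) (hne : ∀ u, c₀ u ≠ 0 → w u ≠ 0) :
    ∃ c : K → ℝ, (∀ u, 0 ≤ c u) ∧ (∑ u, c u • w u = ∑ u, c₀ u • w u) ∧
      ∑ u, c u * g u ≤ ∑ u, c₀ u * g u ∧
      (Function.support c).ncard ≤ Fintype.card E := by
  classical
  -- The last condition keeps the support inside that of `c₀`, where the columns are known to be
  -- nonzero. A member of least support is sought.
  let S : Set (K → ℝ) := {c | (∀ u, 0 ≤ c u) ∧ (∑ u, c u • w u = ∑ u, c₀ u • w u) ∧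
      ∑ u, c u * g u ≤ ∑ u, c₀ u * g u ∧ ∀ u, c u ≠ 0 → c₀ u ≠ 0}
  obtain ⟨c, hcS, hmin⟩ := exists_minimalFor_of_wellFoundedLT (· ∈ S)
    (fun c => (Function.support c).ncard) ⟨c₀, hc₀, rfl, le_rfl, fun _ h => h⟩
  obtain ⟨hc, hcw, hcg, hcs⟩ := hcS
  refine ⟨c, hc, hcw, hcg, ?_⟩
  by_contra! hcard
  have hdep : ¬ LinearIndependent ℝ (fun u : Function.support c => w u) := by
    intro hli
    have := hli.fintype_card_le_finrank
    rw [Module.finrank_fintype_fun_eq_card, ← Nat.card_eq_fintype_card,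
      Nat.card_coe_set_eq] at this
    omega
  rw [Fintype.not_linearIndependent_iff] at hdep
  obtain ⟨v₀, hv₀, ⟨u₀, hu₀⟩, hv₀ne⟩ := hdep
  -- Extend the dependence by zero and choose its sign so that moving along `v` does not raise the
  -- objective.
  have hex : ∃ v : K → ℝ, ∑ u, v u • w u = 0 ∧ (∃ u, v u ≠ 0) ∧ (∀ u, v u ≠ 0 → c u ≠ 0) ∧
      ∑ u, v u * g u ≤ 0 := by
    let v : K → ℝ := fun u => if h : u ∈ Function.support c then v₀ ⟨u, h⟩ else 0
    have hv : ∑ u, v u • w u = 0 := by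
      rw [← hv₀]
      refine (Fintype.sum_of_injective Subtype.val Subtype.val_injective _ _ ?_ ?_).symm
      · intro u hu
        rw [Subtype.range_val] at hu
        simp only [v, dif_neg hu, zero_smul]
      · intro u
        simp only [v, dif_pos u.2]
    have hvne : ∃ u, v u ≠ 0 := ⟨u₀, by simpa only [v, dif_pos hu₀] using hv₀ne⟩
    have hvs : ∀ u, v u ≠ 0 → c u ≠ 0 := by
      intro u h hcu
      exact h (by simp [v, hcu])
    rcases le_total (∑ u, v u * g u) 0 with h | h
    · exact ⟨v, hv, hvne, hvs, h⟩
    · refine ⟨-v, by simp [hv], by simpa using hvne, by simpa using hvs, by simpa using h⟩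
  obtain ⟨v, hv, ⟨u₁, hu₁⟩, hvs, hvg⟩ := hex
  -- Nonnegative columns cannot cancel under nonnegative coefficients.
  have hneg : ∃ u, v u < 0 := by
    by_contra! hpos
    have hwu : w u₁ ≠ 0 := hne _ (hcs _ (hvs _ hu₁))
    refine hwu (funext fun e => ?_)
    have h1 : ∑ u, v u * w u e = 0 := by simpa using congrFun hv e
    have h2 := (Finset.sum_eq_zero_iff_of_nonneg
      (fun u _ => mul_nonneg (hpos u) (hw u e))).1 h1 u₁ (Finset.mem_univ _)
    exact (mul_eq_zero.1 h2).resolve_left hu₁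
  -- The ratio test: this is the longest step along `v` that preserves nonnegativity, and it
  -- annihilates coordinate `u₂`.
  obtain ⟨u₂, hu₂, hmin₂⟩ := Finset.exists_min_image (Finset.univ.filter fun u => v u < 0)
    (fun u => c u / (-v u)) (by simpa [Finset.Nonempty] using hneg)
  simp only [Finset.mem_filter, Finset.mem_univ, true_and] at hu₂ hmin₂
  set t := c u₂ / (-v u₂) with ht
  have ht0 : 0 ≤ t := div_nonneg (hc _) (by linarith)
  have hcu₂ : c u₂ + t * v u₂ = 0 := by
    rw [ht, div_neg, neg_mul, div_mul_cancel₀ _ hu₂.ne, add_neg_cancel]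
  have hsub : Function.support (fun u => c u + t * v u) ⊂ Function.support c := by
    refine (Set.ssubset_iff_of_subset fun u hu => ?_).2 ⟨u₂, hvs _ hu₂.ne, by simp [hcu₂]⟩
    intro hcu
    refine hu ?_
    have : v u = 0 := by_contra fun h => hvs u h hcu
    simp only [this, mul_zero, add_zero]
    exact hcu
  have hlt := Set.ncard_lt_ncard hsub (Set.toFinite _)
  have hmem : (fun u => c u + t * v u) ∈ S := by
    refine ⟨fun u => ?_, ?_, ?_, fun u hu => hcs u (hsub.1 hu)⟩
    · rcases lt_or_ge (v u) 0 with h | h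
      · have h3 := hmin₂ u h
        rw [le_div_iff₀ (by linarith)] at h3
        linarith
      · exact add_nonneg (hc u) (mul_nonneg ht0 h)
    · simp only [add_smul, Finset.sum_add_distrib, mul_smul, ← Finset.smul_sum, hv, smul_zero,
        add_zero, hcw]
    · simp only [add_mul, Finset.sum_add_distrib, mul_assoc, ← Finset.mul_sum]
      nlinarith [mul_nonneg ht0 (neg_nonneg.2 hvg)]
  exact absurd (hmin hmem hlt.le) (by simpa using hlt)

end LinearProgram
-- Dependence of the rates and distortions on letter weights
section Scaling

variable {Y : Fin 2 → Type*} {k : Fin 2 → ℕ}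

/-- The channels `W` with column `u` of `W l` multiplied by `c u`. -/
def scaleChannel (W : ∀ i, Y i → Fin (k i) → ℝ) (l : Fin 2) (c : Fin (k l) → ℝ) :
    ∀ i, Y i → Fin (k i) → ℝ :=
  Function.update W l fun y u => c u * W l y u

variable {W : ∀ i, Y i → Fin (k i) → ℝ} {l : Fin 2} {c : Fin (k l) → ℝ}

theorem scaleChannel_self (y : Y l) (u : Fin (k l)) :
    scaleChannel W l c l y u = c u * W l y u := by
  simp [scaleChannel]

theorem scaleChannel_succ : scaleChannel W l c (l + 1) = W (l + 1) := by
  have : ∀ l : Fin 2, l + 1 ≠ l := by decide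
  exact Function.update_of_ne (this l) _ _

theorem succ_succ_fin_two (i : Fin 2) : i + 1 + 1 = i := by
  revert i; decide

theorem isChannel_scaleChannel (hW : IsChannel W) (hc : ∀ u, 0 ≤ c u)
    (hsum : ∀ y, ∑ u, c u * W l y u = 1) : IsChannel (scaleChannel W l c) := by
  intro i
  have : ∀ i l : Fin 2, i = l ∨ i = l + 1 := by decide
  rcases this i l with rfl | rfl
  · exact fun y => ⟨fun u => by
      rw [scaleChannel_self]; exact mul_nonneg (hc u) ((hW i y).1 u), by
      simpa only [scaleChannel_self] using hsum y⟩
  · rw [scaleChannel_succ]; exact hW _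

variable {p : (∀ i, Y i) → ℝ}

theorem prodJoint_scaleChannel (ω : (∀ i, Y i) × (∀ i, Fin (k i))) :
    prodJoint p (scaleChannel W l c) ω = c (ω.2 l) * prodJoint p W ω := by
  rw [prodJoint, prodJoint, prod_fin_two l, prod_fin_two l, scaleChannel_self, scaleChannel_succ]
  ring

variable [∀ i, Fintype (Y i)]

/-- Up to the multiple `e` of a common nonlinear term, `G (scaleChannel W l c)` is linear in the
weights `c`. -/
def LinearInScale (p : (∀ i, Y i) → ℝ) (W : ∀ i, Y i → Fin (k i) → ℝ) (l : Fin 2) (e : ℝ)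
    (G : (∀ i, Y i → Fin (k i) → ℝ) → ℝ) : Prop :=
  ∃ g : Fin (k l) → ℝ, ∀ c, IsChannel (scaleChannel W l c) →
    G (scaleChannel W l c) =
      e * (∑ ω, prodJoint p W ω * Real.negMulLog (c (ω.2 l))) + ∑ u, c u * g u

theorem LinearInScale.sub {e e' : ℝ} {G G' : (∀ i, Y i → Fin (k i) → ℝ) → ℝ}
    (h : LinearInScale p W l e G) (h' : LinearInScale p W l e' G') :
    LinearInScale p W l (e - e') fun V => G V - G' V := by
  obtain ⟨g, hg⟩ := h
  obtain ⟨g', hg'⟩ := h'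
  refine ⟨fun u => g u - g' u, fun c hc => ?_⟩
  simp only [hg c hc, hg' c hc, mul_sub, Finset.sum_sub_distrib]
  ring

theorem LinearInScale.add {e e' : ℝ} {G G' : (∀ i, Y i → Fin (k i) → ℝ) → ℝ}
    (h : LinearInScale p W l e G) (h' : LinearInScale p W l e' G') :
    LinearInScale p W l (e + e') fun V => G V + G' V := by
  obtain ⟨g, hg⟩ := h
  obtain ⟨g', hg'⟩ := h'
  refine ⟨fun u => g u + g' u, fun c hc => ?_⟩
  simp only [hg c hc, hg' c hc, mul_add, Finset.sum_add_distrib]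
  ring

theorem LinearInScale.const_mul {e : ℝ} {G : (∀ i, Y i → Fin (k i) → ℝ) → ℝ} (a : ℝ)
    (h : LinearInScale p W l e G) : LinearInScale p W l (a * e) fun V => a * G V := by
  obtain ⟨g, hg⟩ := h
  refine ⟨fun u => a * g u, fun c hc => ?_⟩
  simp only [hg c hc, mul_add, Finset.mul_sum]
  congr 1
  · exact Finset.sum_congr rfl fun ω _ => by ring
  · exact Finset.sum_congr rfl fun ω _ => by ring

/-- A constant is linear in the weights because normalization of the scaled channel says that the `c
u`, weighted by the probabilities of the letters, sum to one. -/
theorem linearInScale_const (hp : p ∈ stdSimplex ℝ (∀ i, Y i))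
    {G : (∀ i, Y i → Fin (k i) → ℝ) → ℝ} (a : ℝ)
    (h : ∀ c, IsChannel (scaleChannel W l c) → G (scaleChannel W l c) = a) :
    LinearInScale p W l 0 G := by
  refine ⟨fun u => (∑ y, p y * W l (y l) u) * a, fun c hc => ?_⟩
  have h1 : ∑ u, c u * ∑ y, p y * W l (y l) u = 1 := by
    simp only [Finset.mul_sum]
    rw [Finset.sum_comm, ← hp.2]
    refine Finset.sum_congr rfl fun y _ => ?_
    calc ∑ u, c u * (p y * W l (y l) u) = p y * ∑ u, scaleChannel W l c l (y l) u := by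
          rw [Finset.mul_sum]
          exact Finset.sum_congr rfl fun u _ => by rw [scaleChannel_self]; ring
      _ = p y := by rw [(hc l (y l)).2, mul_one]
  simp only [h c hc, zero_mul, zero_add, ← mul_assoc, ← Finset.sum_mul, h1, one_mul]

/-- Since `X` determines `U_l`, each of its probabilities is multiplied by a single weight, and
`negMulLog` of the product leaves one common nonlinear term whatever `X` is. -/
theorem linearInScale_entropy {A : Type*} [Fintype A]
    (X : (∀ i, Y i) × (∀ i, Fin (k i)) → A) (f : A → Fin (k l)) (hf : ∀ ω, f (X ω) = ω.2 l) :
    LinearInScale p W l 1 fun V => entropy (prodJoint p V) X := by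
  classical
  refine ⟨fun u => ∑ a, if f a = u then Real.negMulLog (law (prodJoint p W) X a) else 0,
    fun c _ => ?_⟩
  have hlaw : ∀ a, law (prodJoint p (scaleChannel W l c)) X a =
      law (prodJoint p W) X a * c (f a) := by
    intro a
    simp only [law_eq_sum_ite, Finset.sum_mul, prodJoint_scaleChannel]
    refine Finset.sum_congr rfl fun ω _ => ?_
    by_cases h : X ω = a
    · simp [h, ← hf, mul_comm]
    · simp [h]
  have h1 := sum_law_mul (prodJoint p W) X fun a => Real.negMulLog (c (f a))
  simp only [hf] at h1
  simp only [entropy_eq_sum_negMulLog, hlaw, Real.negMulLog_mul, Finset.sum_add_distrib, h1,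
    Finset.mul_sum, one_mul]
  rw [add_comm, Finset.sum_comm (s := (Finset.univ : Finset (Fin (k l))))]
  simp

theorem linearInScale_auxEntropy_succ (hp : p ∈ stdSimplex ℝ (∀ i, Y i)) (hW : IsChannel W) :
    LinearInScale p W l 0 fun V => auxEntropy p V (l + 1) := by
  refine linearInScale_const hp (auxEntropy p W (l + 1)) fun c hc => ?_
  simp only [auxEntropy, entropy_eq_sum_negMulLog, law_prodJoint_aux_one hc,
    law_prodJoint_aux_one hW, scaleChannel_succ]

theorem linearInScale_channelEntropy_self (hW : IsChannel W) :
    LinearInScale p W l 1 fun V => channelEntropy p V l := by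
  refine ⟨fun u => ∑ y, p y * Real.negMulLog (W l (y l) u), fun c _ => ?_⟩
  have h1 := sum_law_mul (prodJoint p W) (fun ω => ω.2 l) fun u => Real.negMulLog (c u)
  simp only [law_prodJoint_aux_one hW] at h1
  simp only [channelEntropy, scaleChannel_self, Real.negMulLog_mul, ← h1, one_mul,
    Finset.mul_sum, Finset.sum_mul, mul_add, Finset.sum_add_distrib]
  congr 1
  · rw [Finset.sum_comm]
    exact Finset.sum_congr rfl fun u _ => Finset.sum_congr rfl fun y _ => by ring
  · rw [Finset.sum_comm]
    exact Finset.sum_congr rfl fun u _ => Finset.sum_congr rfl fun y _ => by ring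

theorem linearInScale_channelEntropy_succ (hp : p ∈ stdSimplex ℝ (∀ i, Y i)) :
    LinearInScale p W l 0 fun V => channelEntropy p V (l + 1) :=
  linearInScale_const hp (channelEntropy p W (l + 1)) fun c _ => by
    simp only [channelEntropy, scaleChannel_succ]

/-- The common nonlinear term either occurs twice with opposite signs or not at all. -/
theorem linearInScale_firstRate (hp : p ∈ stdSimplex ℝ (∀ i, Y i)) (hW : IsChannel W)
    (i : Fin 2) : LinearInScale p W l 0 fun V => firstRate p V i := by
  have : ∀ i l : Fin 2, i = l ∨ i = l + 1 := by decide
  rcases this i l with rfl | rfl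
  · have := (linearInScale_entropy (p := p) (W := W) (l := i) (fun ω => ω.2 i) (fun u => u)
      fun _ => rfl).sub (linearInScale_channelEntropy_self hW)
    rwa [sub_self] at this
  · have := (linearInScale_auxEntropy_succ (l := l) hp hW).sub
      (linearInScale_channelEntropy_succ hp)
    rwa [sub_self] at this

theorem linearInScale_secondRate (hp : p ∈ stdSimplex ℝ (∀ i, Y i)) (hW : IsChannel W)
    (i : Fin 2) : LinearInScale p W l 0 fun V => secondRate p V i := by
  have : ∀ i l : Fin 2, i = l ∨ i = l + 1 := by decide
  have hj : LinearInScale p W l 1 fun V => entropy (prodJoint p V) (fun ω => ω.2) :=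
    linearInScale_entropy _ (fun u => u l) fun _ => rfl
  rcases this i l with rfl | rfl
  · have := (hj.sub (linearInScale_auxEntropy_succ hp hW)).sub
      (linearInScale_channelEntropy_self hW)
    rwa [sub_zero, sub_self] at this
  · have h1 : LinearInScale p W l 1 fun V => auxEntropy p V (l + 1 + 1) := by
      rw [succ_succ_fin_two]
      exact linearInScale_entropy _ (fun u => u) fun _ => rfl
    have := (hj.sub h1).sub (linearInScale_channelEntropy_succ hp)
    rwa [sub_zero, sub_self] at this

theorem linearInScale_distortion (i : Fin 2) :
    LinearInScale p W l 0 fun V => distortion p V i := by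
  have := (linearInScale_entropy (p := p) (W := W) (l := l) (fun ω => (ω.1 i, ω.2))
    (fun a => a.2 l) fun _ => rfl).sub
      (linearInScale_entropy (fun ω => ω.2) (fun u => u l) fun _ => rfl)
  rwa [sub_self] at this

end Scaling

/-! ### Reduction of the auxiliary alphabets -/

section Reduction

variable {Y : Fin 2 → Type*} [∀ i, Fintype (Y i)] {k : Fin 2 → ℕ} {p : (∀ i, Y i) → ℝ}

/-- The rate-distortion corner point at which `U_{iᶜ}` is decoded first. -/
def corner (p : (∀ i, Y i) → ℝ) (i : Fin 2) (W : ∀ i, Y i → Fin (k i) → ℝ) :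
    (Fin 2 → ℝ) × (Fin 2 → ℝ) :=
  (fun j => if j = i then secondRate p W j else firstRate p W j, distortion p W)

/-- The letters of the `i`-th auxiliary alphabet that have positive probability for some `y`. -/
def columnSupport (W : ∀ i, Y i → Fin (k i) → ℝ) (i : Fin 2) : Set (Fin (k i)) :=
  {u | ∃ y, W i y u ≠ 0}

theorem linearInScale_corner (hp : p ∈ stdSimplex ℝ (∀ i, Y i))
    {W : ∀ i, Y i → Fin (k i) → ℝ} (hW : IsChannel W) (i l : Fin 2)
    (φ : (Fin 2 → ℝ) × (Fin 2 → ℝ)) :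
    LinearInScale p W l 0 fun V =>
      ∑ j, (φ.1 j * (corner p i V).1 j + φ.2 j * (corner p i V).2 j) := by
  have hr : ∀ j, LinearInScale p W l 0 fun V => (corner p i V).1 j := by
    intro j
    by_cases h : j = i
    · simpa only [corner, if_pos h] using linearInScale_secondRate hp hW j
    · simpa only [corner, if_neg h] using linearInScale_firstRate hp hW j
  have hj : ∀ j, LinearInScale p W l 0 fun V =>
      φ.1 j * (corner p i V).1 j + φ.2 j * (corner p i V).2 j := by
    intro j
    have hd : LinearInScale p W l 0 fun V => (corner p i V).2 j := linearInScale_distortion j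
    have := ((hr j).const_mul (φ.1 j)).add (hd.const_mul (φ.2 j))
    simpa only [mul_zero, add_zero] using this
  simpa only [Fin.sum_univ_two, add_zero] using (hj 0).add (hj 1)

/-- A linear program in the letter weights: normalization gives one equation per letter of `Y l`,
and the objective is linear by `linearInScale_corner`. -/
theorem exists_channel_columnSupport_le (hp : p ∈ stdSimplex ℝ (∀ i, Y i))
    {W : ∀ i, Y i → Fin (k i) → ℝ} (hW : IsChannel W) (i l : Fin 2)
    (φ : (Fin 2 → ℝ) × (Fin 2 → ℝ)) :
    ∃ V : ∀ i, Y i → Fin (k i) → ℝ, IsChannel V ∧ V (l + 1) = W (l + 1) ∧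
      ∑ j, (φ.1 j * (corner p i V).1 j + φ.2 j * (corner p i V).2 j) ≤
        ∑ j, (φ.1 j * (corner p i W).1 j + φ.2 j * (corner p i W).2 j) ∧
      (columnSupport V l).ncard ≤ Fintype.card (Y l) := by
  classical
  obtain ⟨g, hg⟩ := linearInScale_corner hp hW i l φ
  simp only [zero_mul, zero_add] at hg
  -- Zero columns get weight zero instead of one; the channel is unchanged and the nonvanishing
  -- hypothesis of `exists_small_support` holds.
  let c₀ : Fin (k l) → ℝ := fun u => if ∃ y, W l y u ≠ 0 then 1 else 0
  have hc₀W : scaleChannel W l c₀ = W := by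
    refine funext fun j => ?_
    have : ∀ i l : Fin 2, i = l ∨ i = l + 1 := by decide
    rcases this j l with rfl | rfl
    · ext y u
      rw [scaleChannel_self]
      by_cases h : W j y u = 0
      · simp [h]
      · have h' : ∃ y, W j y u ≠ 0 := ⟨y, h⟩
        simp only [c₀, if_pos h', one_mul]
    · exact scaleChannel_succ
  obtain ⟨c, hc, hcw, hcg, hcard⟩ := exists_small_support (fun u y => W l y u) g c₀
    (fun u y => (hW l y).1 u) (fun u => by simp only [c₀]; split_ifs <;> norm_num)
    (fun u hu h => by
      refine hu (if_neg ?_)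
      rintro ⟨y, hy⟩
      exact hy (congrFun h y))
  have hsum : ∀ y, ∑ u, c u * W l y u = 1 := by
    intro y
    have h1 : ∑ u, c u * W l y u = ∑ u, c₀ u * W l y u := by simpa using congrFun hcw y
    have h2 := (hW l y).2
    rw [← hc₀W] at h2
    simp only [scaleChannel_self] at h2
    rw [h1, h2]
  have hV := isChannel_scaleChannel hW hc hsum
  refine ⟨scaleChannel W l c, hV, scaleChannel_succ, ?_, ?_⟩
  · have := hg c₀ (by rwa [hc₀W])
    rw [hc₀W] at this
    rw [hg c hV, this]
    exact hcg
  · refine (Set.ncard_le_ncard ?_ (Set.toFinite _)).trans hcard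
    rintro u ⟨y, hy⟩
    rw [scaleChannel_self] at hy
    exact left_ne_zero_of_mul hy

/-- The auxiliary letters may be relabelled injectively, and those of probability zero dropped. -/
theorem exists_channel_relabel {W : ∀ i, Y i → Fin (k i) → ℝ} (hW : IsChannel W)
    {n : Fin 2 → ℕ} (hn : ∀ i, 0 < n i) (hcard : ∀ i, (columnSupport W i).ncard ≤ n i) :
    ∃ V : ∀ i, Y i → Fin (n i) → ℝ, IsChannel V ∧ ∀ i, secondRate p V i = secondRate p W i ∧
      firstRate p V i = firstRate p W i ∧ distortion p V i = distortion p W i := by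
  classical
  have hf : ∀ i, ∃ f : Fin (k i) → Fin (n i), Set.InjOn f (columnSupport W i) := by
    intro i
    have : Nonempty (columnSupport W i ↪ Fin (n i)) := by
      refine Function.Embedding.nonempty_of_card_le ?_
      rw [← Nat.card_eq_fintype_card, Nat.card_coe_set_eq, Fintype.card_fin]
      exact hcard i
    obtain ⟨e⟩ := this
    -- Letters outside the support go to an arbitrary letter; this is where `0 < n i` is used.
    refine ⟨fun u => if h : u ∈ columnSupport W i then e ⟨u, h⟩ else ⟨0, hn i⟩, ?_⟩
    intro u hu v hv huv
    simp only [dif_pos hu, dif_pos hv] at huv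
    exact congrArg Subtype.val (e.injective huv)
  choose f hf using hf
  let V : ∀ i, Y i → Fin (n i) → ℝ := fun i y => law (W i y) (f i)
  have hV : IsChannel V := fun i y => law_mem_stdSimplex (hW i y) (f i)
  let Φ : (∀ i, Y i) × (∀ i, Fin (k i)) → (∀ i, Y i) × (∀ i, Fin (n i)) :=
    fun ω => (ω.1, fun i => f i (ω.2 i))
  -- The new joint pmf is the image of the old one under relabelling, so entropies are preserved by
  -- injectivity on the support.
  have hJ : prodJoint p V = law (prodJoint p W) Φ := by
    ext ⟨y, t⟩
    simp only [prodJoint, V, law, Finset.prod_univ_sum]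
    rw [Finset.mul_sum]
    refine Finset.sum_bij' (fun u _ => (y, u)) (fun ω _ => ω.2) ?_ ?_ ?_ ?_ ?_
    · intro u hu
      simp only [Fintype.mem_piFinset, Finset.mem_filter, Finset.mem_univ, true_and] at hu
      simp [Φ, hu]
    · intro ω hω
      simp only [Finset.mem_filter, Finset.mem_univ, true_and, Φ, Prod.mk.injEq] at hω
      simp [← hω.2]
    · intro u _; rfl
    · intro ω hω
      simp only [Finset.mem_filter, Finset.mem_univ, true_and, Φ, Prod.mk.injEq] at hω
      rw [← hω.1]
    · intro u _; rfl
  have hsupp : ∀ ω, prodJoint p W ω ≠ 0 → ∀ i, ω.2 i ∈ columnSupport W i := by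
    intro ω hω i
    refine ⟨ω.1 i, fun h => hω ?_⟩
    rw [prodJoint, Finset.prod_eq_zero (Finset.mem_univ i) h, mul_zero]
  have hU : ∀ i, auxEntropy p V i = auxEntropy p W i := fun i => by
    rw [auxEntropy, hJ]
    refine entropy_law_of_ne_zero _ _ _ _ fun ω ω' h h' => ?_
    exact (hf i).eq_iff (hsupp ω h i) (hsupp ω' h' i)
  have hpi : ∀ ω ω', prodJoint p W ω ≠ 0 → prodJoint p W ω' ≠ 0 →
      ((Φ ω).2 = (Φ ω').2 ↔ ω.2 = ω'.2) := by
    intro ω ω' h h'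
    simp only [Φ, funext_iff]
    exact forall_congr' fun i => (hf i).eq_iff (hsupp ω h i) (hsupp ω' h' i)
  have hUU : entropy (prodJoint p V) (fun ω => ω.2) = entropy (prodJoint p W) (fun ω => ω.2) := by
    rw [hJ]
    exact entropy_law_of_ne_zero _ _ _ _ hpi
  have hYU : ∀ i, entropy (prodJoint p V) (fun ω => (ω.1 i, ω.2)) =
      entropy (prodJoint p W) (fun ω => (ω.1 i, ω.2)) := fun i => by
    rw [hJ]
    refine entropy_law_of_ne_zero _ _ _ _ fun ω ω' h h' => ?_
    rw [Prod.mk.injEq, Prod.mk.injEq, hpi ω ω' h h']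
  have hc : ∀ i, channelEntropy p V i = channelEntropy p W i := fun i => by
    refine Finset.sum_congr rfl fun y _ => congrArg _ ?_
    have h1 : entropy (W i (y i)) (f i) = entropy (W i (y i)) id :=
      entropy_congr_of_ne_zero _ fun u u' h h' => (hf i).eq_iff ⟨_, h⟩ ⟨_, h'⟩
    rw [entropy_eq_sum_negMulLog, entropy_eq_sum_negMulLog] at h1
    simpa only [show ∀ u, law (W i (y i)) id u = W i (y i) u from
      law_of_injective _ Function.injective_id] using h1
  exact ⟨V, hV, fun i => ⟨by rw [secondRate, secondRate, hUU, hU, hc],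
    by rw [firstRate, firstRate, hU, hc], by rw [distortion, distortion, hYU, hUU]⟩⟩

/-- Every linear functional of the corner points is minimized by auxiliary alphabets that are no
larger than the source alphabets. -/
theorem exists_channel_card_eq (hp : p ∈ stdSimplex ℝ (∀ i, Y i))
    {W : ∀ i, Y i → Fin (k i) → ℝ} (hW : IsChannel W) (i : Fin 2)
    (φ : (Fin 2 → ℝ) × (Fin 2 → ℝ)) :
    ∃ V : ∀ i, Y i → Fin (Fintype.card (Y i)) → ℝ, IsChannel V ∧
      ∑ j, (φ.1 j * (corner p i V).1 j + φ.2 j * (corner p i V).2 j) ≤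
        ∑ j, (φ.1 j * (corner p i W).1 j + φ.2 j * (corner p i W).2 j) := by
  have : Nonempty (∀ i, Y i) := by
    by_contra h
    rw [not_nonempty_iff] at h
    simpa using hp.2
  -- One channel at a time: the second reduction does not touch channel `0`, so the first support
  -- bound survives.
  obtain ⟨W', hW', -, hle', hcard'⟩ := exists_channel_columnSupport_le hp hW i 0 φ
  obtain ⟨W'', hW'', heq, hle'', hcard''⟩ := exists_channel_columnSupport_le hp hW' i 1 φ
  obtain ⟨V, hV, hVW⟩ := exists_channel_relabel (p := p) hW''
    (n := fun i => Fintype.card (Y i)) (fun i => Fintype.card_pos_iff.2 (this.map (· i)))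
    (Fin.forall_fin_two.2 ⟨by
      have : columnSupport W'' 0 = columnSupport W' 0 := by
        have heq : W'' 0 = W' 0 := heq
        simp only [columnSupport, heq]
      rwa [this], hcard''⟩)
  refine ⟨V, hV, le_trans (le_of_eq ?_) (hle''.trans hle')⟩
  simp only [corner, hVW]

end Reduction
-- Carathéodory's theorem and compactness of convex hulls
section ConvexHull

variable {E : Type*} [AddCommGroup E] [Module ℝ E] {s : Set E}

/-- Carathéodory's theorem, with the number of points bounded by the dimension. -/
theorem exists_sum_eq_of_mem_convexHull [FiniteDimensional ℝ E] {x : E}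
    (hx : x ∈ convexHull ℝ s) :
    ∃ m ≤ Module.finrank ℝ E + 1, ∃ w ∈ stdSimplex ℝ (Fin m), ∃ z : Fin m → E,
      (∀ q, z q ∈ s) ∧ ∑ q, w q • z q = x := by
  obtain ⟨ι, _, z, w, hz, hind, hw, hw1, hx⟩ := eq_pos_convex_span_of_mem_convexHull hx
  let e := Fintype.equivFin ι
  refine ⟨Fintype.card ι, hind.card_le_finrank_succ.trans
    (Nat.add_le_add_right (Submodule.finrank_le _) 1), w ∘ e.symm, ⟨fun q => (hw _).le, ?_⟩,
    z ∘ e.symm, fun q => hz ⟨_, rfl⟩, ?_⟩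
  · rw [← hw1]; exact e.symm.sum_comp w
  · rw [← hx]; exact e.symm.sum_comp fun i => w i • z i

theorem sum_smul_mem_convexHull {m : ℕ} {w : Fin m → ℝ} (hw : w ∈ stdSimplex ℝ (Fin m))
    {z : Fin m → E} (hz : ∀ q, z q ∈ s) : ∑ q, w q • z q ∈ convexHull ℝ s :=
  (convex_convexHull ℝ s).sum_mem (fun q _ => hw.1 q) hw.2
    fun q _ => subset_convexHull ℝ s (hz q)

/-- By Carathéodory the hull is a finite union of continuous images of compact sets of weights and
points. -/
theorem isCompact_convexHull_of_finiteDimensional [FiniteDimensional ℝ E] [TopologicalSpace E]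
    [ContinuousAdd E] [ContinuousSMul ℝ E] (hs : IsCompact s) : IsCompact (convexHull ℝ s) := by
  have h : convexHull ℝ s = ⋃ m ∈ Set.Iic (Module.finrank ℝ E + 1),
      (fun a : (Fin m → ℝ) × (Fin m → E) => ∑ q, a.1 q • a.2 q) ''
        (stdSimplex ℝ (Fin m) ×ˢ Set.univ.pi fun _ => s) := by
    ext x
    simp only [Set.mem_iUnion, Set.mem_image, Set.mem_prod, Set.mem_univ_pi, Prod.exists,
      Set.mem_Iic, exists_prop]
    constructor
    · intro hx
      obtain ⟨m, hm, w, hw, z, hz, hx⟩ := exists_sum_eq_of_mem_convexHull hx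
      exact ⟨m, hm, w, z, ⟨hw, hz⟩, hx⟩
    · rintro ⟨m, -, w, z, ⟨hw, hz⟩, rfl⟩
      exact sum_smul_mem_convexHull hw hz
  rw [h]
  exact (Set.finite_Iic _).isCompact_biUnion fun m _ =>
    ((isCompact_stdSimplex ℝ (Fin m)).prod (isCompact_univ_pi fun _ => hs)).image (by fun_prop)

end ConvexHull

/-! ### Averaging over the time-sharing variable -/

section TimeSharing

variable {Ω A B C Q : Type*} [Fintype Ω] [Fintype A] [Fintype B] [Fintype C] [Fintype Q]

theorem condMutualInfo_time_sharing (pQ : Q → ℝ) (P : Q → Ω → ℝ) (X : Ω → A) (Z : Ω → B)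
    (T : Ω → C) :
    condMutualInfo (fun ω : Q × Ω => pQ ω.1 * P ω.1 ω.2) (fun ω => X ω.2) (fun ω => Z ω.2)
      (fun ω => (T ω.2, ω.1)) = ∑ q, pQ q * condMutualInfo (P q) X Z T := by
  have h : condEntropy (fun ω : Q × Ω => pQ ω.1 * P ω.1 ω.2) (fun ω => X ω.2)
      (fun ω => (Z ω.2, (T ω.2, ω.1))) = _ :=
    (condEntropy_congr_right _ _ fun ω ω' => by simp only [Prod.mk.injEq, and_assoc]).trans
      (condEntropy_time_sharing pQ P X fun ω => (Z ω, T ω))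
  simp only [condMutualInfo, h, condEntropy_time_sharing, mul_sub, Finset.sum_sub_distrib]

theorem condMutualInfo_time_sharing_unit (pQ : Q → ℝ) (P : Q → Ω → ℝ) (X : Ω → A) (Z : Ω → B) :
    condMutualInfo (fun ω : Q × Ω => pQ ω.1 * P ω.1 ω.2) (fun ω => X ω.2) (fun ω => Z ω.2)
      (fun ω => ω.1) = ∑ q, pQ q * condMutualInfo (P q) X Z (fun _ => ()) := by
  rw [← condMutualInfo_time_sharing, condMutualInfo, condMutualInfo]
  congr 1
  · exact condEntropy_congr_right _ _ fun ω ω' => by simp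
  · exact condEntropy_congr_right _ _ fun ω ω' => by simp

end TimeSharing

/-! ### Structure of the regions and the two inclusions -/

section Regions

open scoped Pointwise

variable {Y : Fin 2 → Type*} [∀ i, Fintype (Y i)] {p : (∀ i, Y i) → ℝ}

theorem mem_btRegion_iff (hp : p ∈ stdSimplex ℝ (∀ i, Y i)) (x : (Fin 2 → ℝ) × (Fin 2 → ℝ)) :
    x ∈ btRegion p ↔ ∃ (m : ℕ) (k : Fin 2 → ℕ) (pQ : Fin m → ℝ)
      (V : Fin m → ∀ i, Y i → Fin (k i) → ℝ), m ≤ 5 ∧ (∀ i, k i ≤ Fintype.card (Y i)) ∧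
        pQ ∈ stdSimplex ℝ (Fin m) ∧ (∀ q, IsChannel (V q)) ∧
        (∀ i, ∑ q, pQ q * secondRate p (V q) i ≤ x.1 i) ∧
        ∑ q, pQ q * (secondRate p (V q) 0 + firstRate p (V q) 1) ≤ x.1 0 + x.1 1 ∧
        ∀ i, ∑ q, pQ q * distortion p (V q) i ≤ x.2 i := by
  have key : ∀ (m : ℕ) (k : Fin 2 → ℕ) (pQ : Fin m → ℝ)
      (W : ∀ i, Y i → Fin m → Fin (k i) → ℝ), (∀ q, IsChannel fun i y => W i y q) →
      (∀ i, condMutualInfo (btJoint p pQ W) (fun ω => ω.2.2 i) (fun ω => ω.2.1 i)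
        (fun ω => (ω.2.2 (i + 1), ω.1)) =
          ∑ q, pQ q * secondRate p (fun i y => W i y q) i) ∧
      condMutualInfo (btJoint p pQ W) (fun ω => ω.2.2) (fun ω => ω.2.1) (fun ω => ω.1) =
        ∑ q, pQ q * (secondRate p (fun i y => W i y q) 0 + firstRate p (fun i y => W i y q) 1) ∧
      ∀ i, condEntropy (btJoint p pQ W) (fun ω => ω.2.1 i) (fun ω => (ω.2.2, ω.1)) =
        ∑ q, pQ q * distortion p (fun i y => W i y q) i := by
    intro m k pQ W hW
    have hbt : btJoint p pQ W = fun ω => pQ ω.1 * prodJoint p (fun i y => W i y ω.1) ω.2 := by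
      ext ω
      simp only [btJoint, prodJoint, mul_assoc]
    rw [hbt]
    refine ⟨fun i => ?_, ?_, fun i => ?_⟩
    · refine (condMutualInfo_time_sharing pQ (fun q => prodJoint p fun i y => W i y q)
        (fun ω => ω.2 i) (fun ω => ω.1 i) (fun ω => ω.2 (i + 1))).trans ?_
      exact Finset.sum_congr rfl fun q _ => by rw [condMutualInfo_aux_source hp (hW q)]
    · refine (condMutualInfo_time_sharing_unit pQ (fun q => prodJoint p fun i y => W i y q)
        (fun ω => ω.2) (fun ω => ω.1)).trans ?_
      exact Finset.sum_congr rfl fun q _ => by rw [condMutualInfo_aux_source_unit hp (hW q)]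
    · refine (condEntropy_time_sharing pQ (fun q => prodJoint p fun i y => W i y q)
        (fun ω => ω.1 i) (fun ω => ω.2)).trans ?_
      exact Finset.sum_congr rfl fun q _ => by rw [condEntropy_source_aux hp (hW q)]
  constructor
  · rintro ⟨m, k, pQ, W, hm, hk, hpQ, hW, h1, h2, h3⟩
    have hW' : ∀ q, IsChannel fun i y => W i y q := fun q i y => hW i y q
    obtain ⟨k1, k2, k3⟩ := key m k pQ W hW'
    exact ⟨m, k, pQ, fun q i y => W i y q, hm, hk, hpQ, hW', fun i => k1 i ▸ h1 i, k2 ▸ h2,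
      fun i => k3 i ▸ h3 i⟩
  · rintro ⟨m, k, pQ, V, hm, hk, hpQ, hV, h1, h2, h3⟩
    obtain ⟨k1, k2, k3⟩ := key m k pQ (fun i y q => V q i y) hV
    exact ⟨m, k, pQ, fun i y q => V q i y, hm, hk, hpQ, fun i y q => hV q i y,
      fun i => (k1 i).trans_le (h1 i), k2.trans_le h2, fun i => (k3 i).trans_le (h3 i)⟩

/-- The corner points of all pairs of channels whose output alphabets are as large as the source
alphabets. -/
def cornerSet (p : (∀ i, Y i) → ℝ) : Set ((Fin 2 → ℝ) × (Fin 2 → ℝ)) :=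
  {x | ∃ (i : Fin 2) (V : ∀ i, Y i → Fin (Fintype.card (Y i)) → ℝ), IsChannel V ∧
    corner p i V = x}

theorem corner_rate_sum {k : Fin 2 → ℕ} (i : Fin 2) (W : ∀ i, Y i → Fin (k i) → ℝ) :
    (corner p i W).1 0 + (corner p i W).1 1 = secondRate p W 0 + firstRate p W 1 := by
  revert i
  refine Fin.forall_fin_two.2 ⟨by simp [corner], ?_⟩
  have := secondRate_add_firstRate (p := p) (W := W) 1
  rw [← this]
  simp [corner, add_comm]

theorem continuous_entropy_prodJoint {k : Fin 2 → ℕ} {A : Type*} [Fintype A]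
    (X : (∀ i, Y i) × (∀ i, Fin (k i)) → A) :
    Continuous fun W : ∀ i, Y i → Fin (k i) → ℝ => entropy (prodJoint p W) X := by
  simp only [entropy_eq_sum_negMulLog, law, prodJoint]
  fun_prop

theorem continuous_corner {k : Fin 2 → ℕ} (i : Fin 2) :
    Continuous fun W : ∀ i, Y i → Fin (k i) → ℝ => corner p i W := by
  have hU : ∀ i, Continuous fun W : ∀ i, Y i → Fin (k i) → ℝ => auxEntropy p W i :=
    fun i => continuous_entropy_prodJoint _
  have hc : ∀ i, Continuous fun W : ∀ i, Y i → Fin (k i) → ℝ => channelEntropy p W i := by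
    intro i
    simp only [channelEntropy]
    fun_prop
  refine (continuous_pi fun j => ?_).prodMk (continuous_pi fun j => ?_)
  · by_cases h : j = i
    · simp only [if_pos h]
      exact ((continuous_entropy_prodJoint _).sub (hU _)).sub (hc _)
    · simp only [if_neg h]
      exact (hU _).sub (hc _)
  · exact (continuous_entropy_prodJoint _).sub (continuous_entropy_prodJoint _)

theorem isCompact_cornerSet : IsCompact (cornerSet p) := by
  have h : cornerSet p = ⋃ i, corner p i ''
      {V : ∀ i, Y i → Fin (Fintype.card (Y i)) → ℝ | IsChannel V} := by
    ext x
    simp [cornerSet]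
  rw [h]
  refine isCompact_iUnion fun i => IsCompact.image ?_ (continuous_corner i)
  have : {V : ∀ i, Y i → Fin (Fintype.card (Y i)) → ℝ | IsChannel V} =
      Set.univ.pi fun i => Set.univ.pi fun _ => stdSimplex ℝ (Fin (Fintype.card (Y i))) := by
    ext V
    simp [IsChannel]
  rw [this]
  exact isCompact_univ_pi fun i => isCompact_univ_pi fun _ => isCompact_stdSimplex ℝ _

/-- Averaged over `Q`, the two corners share their sum rate and distortions, and each minimizes the
rate of one encoder; a suitable mixture lies below any admissible point. Conversely a corner meets
all the Berger-Tung bounds, by `secondRate_le_firstRate` and `corner_rate_sum`. -/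
theorem btRegion_eq_upper_convexHull (hp : p ∈ stdSimplex ℝ (∀ i, Y i)) :
    btRegion p = convexHull ℝ (cornerSet p) + Set.Ici 0 := by
  have : Nonempty (∀ i, Y i) := by
    by_contra h
    rw [not_nonempty_iff] at h
    simpa using hp.2
  have hcard : ∀ i, 0 < Fintype.card (Y i) := fun i => Fintype.card_pos_iff.2 (this.map (· i))
  ext x
  rw [mem_btRegion_iff hp]
  constructor
  · rintro ⟨m, k, pQ, V₀, -, hk, hpQ, hV₀, h1, h2, h3⟩
    -- Pad alphabets of size at most `card (Y i)` to exactly that size, as `cornerSet` requires.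
    have hrel := fun q => exists_channel_relabel (p := p) (hV₀ q)
      (n := fun i => Fintype.card (Y i)) hcard fun i =>
        ((Set.ncard_le_card _).trans_eq (Nat.card_fin _)).trans (hk i)
    choose V hV hVe using hrel
    simp only [← fun q i => (hVe q i).1, ← fun q i => (hVe q i).2.1,
      ← fun q i => (hVe q i).2.2] at h1 h2 h3
    let z : Fin 2 → (Fin 2 → ℝ) × (Fin 2 → ℝ) := fun i => ∑ q, pQ q • corner p i (V q)
    have hz : ∀ i, z i ∈ convexHull ℝ (cornerSet p) := fun i =>
      sum_smul_mem_convexHull hpQ fun q => ⟨i, V q, hV q, rfl⟩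
    have hz1 : ∀ i j, (z i).1 j = ∑ q, pQ q * (corner p i (V q)).1 j := fun i j => by
      simp [z, Prod.fst_sum, Finset.sum_apply]
    have hz2 : ∀ i j, (z i).2 j = ∑ q, pQ q * distortion p (V q) j := fun i j => by
      simp [z, Prod.snd_sum, Finset.sum_apply, corner]
    have hA : ∀ i, (z i).1 i ≤ x.1 i := fun i => by
      simpa [hz1, corner] using h1 i
    have hS : ∀ i, (z i).1 0 + (z i).1 1 ≤ x.1 0 + x.1 1 := fun i => by
      rw [hz1, hz1, ← Finset.sum_add_distrib]
      simpa only [← mul_add, corner_rate_sum] using h2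
    have hS' : (z 0).1 0 + (z 0).1 1 = (z 1).1 0 + (z 1).1 1 := by
      simp only [hz1, ← Finset.sum_add_distrib, ← mul_add, corner_rate_sum]
    -- If `z 1` already fits under the first rate, take it alone. Otherwise mix so that the first
    -- rate is met with equality; the sum-rate bound then controls the second.
    have hmain : ∃ a b : ℝ, 0 ≤ a ∧ 0 ≤ b ∧ a + b = 1 ∧
        ∀ j, a * (z 0).1 j + b * (z 1).1 j ≤ x.1 j := by
      have h00 := hA 0
      have h11 := hA 1
      have hS0 := hS 0
      rcases le_or_gt ((z 1).1 0) (x.1 0) with h | h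
      · exact ⟨0, 1, le_rfl, zero_le_one, by norm_num, Fin.forall_fin_two.2
          ⟨by linarith, by linarith⟩⟩
      · have hd : 0 < (z 1).1 0 - (z 0).1 0 := by linarith
        have hb : (x.1 0 - (z 0).1 0) / ((z 1).1 0 - (z 0).1 0) *
            ((z 1).1 0 - (z 0).1 0) = x.1 0 - (z 0).1 0 := div_mul_cancel₀ _ hd.ne'
        set b := (x.1 0 - (z 0).1 0) / ((z 1).1 0 - (z 0).1 0)
        have hb1 : b ≤ 1 := (div_le_one hd).2 (by linarith)
        refine ⟨1 - b, b, by linarith, div_nonneg (by linarith) hd.le, by ring,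
          Fin.forall_fin_two.2 ⟨by linarith, ?_⟩⟩
        have e1 : (z 0).1 1 = (z 1).1 0 + (z 1).1 1 - (z 0).1 0 := by linarith
        rw [e1]
        linarith
    obtain ⟨a, b, ha, hb, hab, hr⟩ := hmain
    refine ⟨_, convex_convexHull ℝ _ (hz 0) (hz 1) ha hb hab, x - (a • z 0 + b • z 1), ?_,
      add_sub_cancel _ _⟩
    rw [Set.mem_Ici, sub_nonneg]
    refine ⟨fun j => by simpa using hr j, fun j => ?_⟩
    have : a * (z 0).2 j + b * (z 1).2 j = ∑ q, pQ q * distortion p (V q) j := by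
      rw [hz2, hz2, ← add_mul, hab, one_mul]
    simpa [this] using h3 j
  · rintro ⟨z, hz, v, hv, rfl⟩
    obtain ⟨m, hm, w, hw, c, hc, rfl⟩ := exists_sum_eq_of_mem_convexHull hz
    choose i V hV hVc using hc
    have hv1 : ∀ j, 0 ≤ v.1 j := fun j => hv.1 j
    have hv2 : ∀ j, 0 ≤ v.2 j := fun j => hv.2 j
    -- The bound `m ≤ 5` is the dimension `2 + 2` plus one.
    refine ⟨m, _, w, V, hm.trans (by simp), fun i => le_rfl, hw, hV, fun j => ?_, ?_, fun j => ?_⟩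
    · have : ∑ q, w q * secondRate p (V q) j ≤ ∑ q, w q * (c q).1 j := by
        refine Finset.sum_le_sum fun q _ => mul_le_mul_of_nonneg_left ?_ (hw.1 q)
        rw [← hVc q, corner]
        dsimp only
        split_ifs
        · exact le_rfl
        · exact secondRate_le_firstRate hp (hV q) j
      simpa [Prod.fst_sum, Finset.sum_apply] using this.trans (le_add_of_nonneg_right (hv1 j))
    · have : ∑ q, w q * (secondRate p (V q) 0 + firstRate p (V q) 1) =
          ∑ q, w q * (c q).1 0 + ∑ q, w q * (c q).1 1 := by
        rw [← Finset.sum_add_distrib]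
        refine Finset.sum_congr rfl fun q _ => ?_
        rw [← mul_add, ← hVc q, corner_rate_sum]
      simp only [Prod.fst_add, Prod.fst_sum, Prod.smul_fst, Pi.add_apply, Finset.sum_apply,
        Pi.smul_apply, smul_eq_mul, this]
      linarith [hv1 0, hv1 1]
    · have : ∑ q, w q * distortion p (V q) j = ∑ q, w q * (c q).2 j :=
        Finset.sum_congr rfl fun q _ => by rw [← hVc q, corner]
      simpa [Prod.snd_sum, Finset.sum_apply, this] using hv2 j

theorem corner_mem_btRegion (hp : p ∈ stdSimplex ℝ (∀ i, Y i))
    {V : ∀ i, Y i → Fin (Fintype.card (Y i)) → ℝ} (hV : IsChannel V) (i : Fin 2) :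
    corner p i V ∈ btRegion p := by
  rw [btRegion_eq_upper_convexHull hp]
  exact ⟨_, subset_convexHull ℝ _ ⟨i, V, hV, rfl⟩, 0, Set.self_mem_Ici, add_zero _⟩

theorem convex_btRegion (hp : p ∈ stdSimplex ℝ (∀ i, Y i)) : Convex ℝ (btRegion p) := by
  rw [btRegion_eq_upper_convexHull hp]
  exact (convex_convexHull ℝ _).add (convex_Ici 0)

/-- Compactness of the hull matters here: a compact set plus a closed set is closed. -/
theorem isClosed_btRegion (hp : p ∈ stdSimplex ℝ (∀ i, Y i)) : IsClosed (btRegion p) := by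
  rw [btRegion_eq_upper_convexHull hp]
  exact isClosed_Ici.add_left_of_isCompact
    (isCompact_convexHull_of_finiteDimensional isCompact_cornerSet)

theorem add_mem_btRegion (hp : p ∈ stdSimplex ℝ (∀ i, Y i)) {x v : (Fin 2 → ℝ) × (Fin 2 → ℝ)}
    (hx : x ∈ btRegion p) (hv : 0 ≤ v) : x + v ∈ btRegion p := by
  rw [btRegion_eq_upper_convexHull hp] at hx ⊢
  obtain ⟨z, hz, v', hv', rfl⟩ := hx
  exact ⟨z, hz, v' + v, add_nonneg hv' hv, (add_assoc _ _ _).symm⟩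

theorem corner_mem_swzRegion (hp : p ∈ stdSimplex ℝ (∀ i, Y i)) {k : Fin 2 → ℕ}
    {W : ∀ i, Y i → Fin (k i) → ℝ} (hW : IsChannel W) (i : Fin 2) :
    corner p i W ∈ swzRegion p i := by
  intro α _
  refine sInf_le ⟨k, prodJoint p W, isTestPmf_prodJoint hp hW, ?_, ?_, ?_⟩
  · rw [condMutualInfo_source_aux hp hW]
    simp [corner]
  · rw [mutualInfo_source_aux hp hW]
    simp [corner]
  · rw [condEntropy_source_aux hp hW, condEntropy_source_aux hp hW]
    rfl

/-- Larger rates enlarge the feasible set and so lower the infimum; larger distortions raise the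
other side. -/
theorem add_mem_swzRegion {i : Fin 2} {x v : (Fin 2 → ℝ) × (Fin 2 → ℝ)}
    (hx : x ∈ swzRegion p i) (hv : 0 ≤ v) : x + v ∈ swzRegion p i := by
  intro α hα
  have hv1 : ∀ j, 0 ≤ v.1 j := fun j => hv.1 j
  have hv2 : ∀ j, 0 ≤ v.2 j := fun j => hv.2 j
  refine le_trans (sInf_le_sInf ?_) ((hx α hα).trans (EReal.coe_le_coe_iff.2 ?_))
  · rintro d ⟨k, J, hJ, h1, h2, h3⟩
    exact ⟨k, J, hJ, h1.trans (le_add_of_nonneg_right (hv1 _)),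
      h2.trans (le_add_of_nonneg_right (hv1 _)), h3⟩
  · have h0 := mul_nonneg hα.1 (hv2 0)
    have h1 := mul_nonneg (sub_nonneg.2 hα.2) (hv2 1)
    simp only [Prod.snd_add, Pi.add_apply]
    linarith

theorem btRegion_subset (hp : p ∈ stdSimplex ℝ (∀ i, Y i)) :
    btRegion p ⊆ convexHull ℝ (swzRegion p 0 ∪ swzRegion p 1) := by
  rw [btRegion_eq_upper_convexHull hp]
  rintro _ ⟨z, hz, v, hv, rfl⟩
  -- All corners are shifted by the same `v`, and taking hulls commutes with translation.
  have hsub : (fun y => y + v) '' cornerSet p ⊆ swzRegion p 0 ∪ swzRegion p 1 := by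
    rintro _ ⟨_, ⟨i, V, hV, rfl⟩, rfl⟩
    have := add_mem_swzRegion (corner_mem_swzRegion hp hV i) hv
    revert i
    exact Fin.forall_fin_two.2 ⟨fun h => Or.inl h, fun h => Or.inr h⟩
  refine convexHull_mono hsub ?_
  have h : (fun y => y + v) '' cornerSet p = cornerSet p + {v} := by simp
  rw [h, convexHull_add, convexHull_singleton]
  exact Set.add_mem_add hz rfl

theorem apply_eq_sum_coord (f : ((Fin 2 → ℝ) × (Fin 2 → ℝ)) →ₗ[ℝ] ℝ)
    (x : (Fin 2 → ℝ) × (Fin 2 → ℝ)) :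
    f x = ∑ j, (f (Pi.single j 1, 0) * x.1 j + f (0, Pi.single j 1) * x.2 j) := by
  have hx : x = ∑ j, (x.1 j • ((Pi.single j 1, 0) : (Fin 2 → ℝ) × (Fin 2 → ℝ)) +
      x.2 j • ((0, Pi.single j 1) : (Fin 2 → ℝ) × (Fin 2 → ℝ))) := by
    refine Prod.ext (funext fun j => ?_) (funext fun j => ?_) <;>
    · revert j
      refine Fin.forall_fin_two.2 ⟨?_, ?_⟩ <;> simp [Fin.sum_univ_two]
  conv_lhs => rw [hx]
  simp only [map_sum, map_add, map_smul, smul_eq_mul, mul_comm]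

theorem swzRegion_subset (hp : p ∈ stdSimplex ℝ (∀ i, Y i)) (i : Fin 2) :
    swzRegion p i ⊆ btRegion p := by
  intro x hx
  by_contra hxB
  obtain ⟨f, u, hfx, hfB⟩ := geometric_hahn_banach_point_closed (convex_btRegion hp)
    (isClosed_btRegion hp) hxB
  set φ : (Fin 2 → ℝ) × (Fin 2 → ℝ) :=
    (fun j => f (Pi.single j 1, 0), fun j => f (0, Pi.single j 1)) with hφ
  have hf : ∀ x, f x = ∑ j, (φ.1 j * x.1 j + φ.2 j * x.2 j) := fun x =>
    apply_eq_sum_coord f.toLinearMap x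
  -- The value at `α = 0` is below `⊤`, so a test pmf exists; it serves only to exhibit a point of
  -- the Berger-Tung region.
  obtain ⟨k₀, J₀, hJ₀, -⟩ : ∃ (k : Fin 2 → ℕ) (J : (∀ i, Y i) × (∀ i, Fin (k i)) → ℝ),
      IsTestPmf p J ∧ True := by
    have h := (hx 0 (by simp)).trans_lt (EReal.coe_lt_top _)
    obtain ⟨d, ⟨k, J, hJ, -⟩, -⟩ := sInf_lt_iff.1 h
    exact ⟨k, J, hJ, trivial⟩
  obtain ⟨W₀, hW₀, -⟩ := hJ₀.exists_channel
  obtain ⟨V₀, hV₀, -⟩ := exists_channel_card_eq hp hW₀ i 0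
  have hpos : ∀ v, 0 ≤ v → 0 ≤ f v := by
    intro v hv
    by_contra! hneg
    have h0 := hfB _ (corner_mem_btRegion hp hV₀ i)
    -- If `f v` were negative, this multiple of `v` would bring the value of `f` down to `u` without
    -- leaving the region.
    have ht : 0 ≤ (f (corner p i V₀) - u) / (-f v) := div_nonneg (by linarith) (by linarith)
    have h1 := hfB _ (add_mem_btRegion hp (corner_mem_btRegion hp hV₀ i) (smul_nonneg ht hv))
    rw [map_add, map_smul, smul_eq_mul, div_neg, neg_mul, div_mul_cancel₀ _ hneg.ne] at h1
    linarith
  have hφ1 : ∀ j, 0 ≤ φ.1 j := fun j => hpos _ ⟨by simp, le_rfl⟩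
  have hφ2 : ∀ j, 0 ≤ φ.2 j := fun j => hpos _ ⟨le_rfl, by simp⟩
  set M := φ.2 0 + φ.2 1 with hM
  set α := φ.2 0 / M with hα
  have hM0 : 0 ≤ M := add_nonneg (hφ2 0) (hφ2 1)
  -- Also true when `M = 0`: both distortion coefficients then vanish and the value of `α` is
  -- irrelevant.
  have hMα : M * α = φ.2 0 := by
    rcases hM0.eq_or_lt with h | h
    · rw [← h, zero_mul]
      linarith [hφ2 0, hφ2 1]
    · rw [hα, mul_div_cancel₀ _ h.ne']
  have hα01 : α ∈ Set.Icc (0 : ℝ) 1 :=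
    ⟨div_nonneg (hφ2 0) hM0, div_le_one_of_le₀ (by linarith [hφ2 1]) hM0⟩
  -- Chosen so that `M * ε < u - f x`, with `M + 1` to allow `M = 0`. The infimum is approached to
  -- within `ε`, so its attainment is not needed.
  set ε := (u - f x) / (M + 1) with hε
  have hε0 : 0 < ε := div_pos (by linarith) (by linarith)
  have hMε : M * ε + ε = u - f x := by
    rw [hε]; field_simp
  have hlt := (hx α hα01).trans_lt (EReal.coe_lt_coe_iff.2
    (lt_add_of_pos_right (α * x.2 0 + (1 - α) * x.2 1) hε0))
  obtain ⟨d, ⟨k, J, hJ, h1, h2, rfl⟩, hd⟩ := sInf_lt_iff.1 hlt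
  obtain ⟨W, hW, rfl⟩ := hJ.exists_channel
  rw [EReal.coe_lt_coe_iff, condEntropy_source_aux hp hW, condEntropy_source_aux hp hW] at hd
  rw [condMutualInfo_source_aux hp hW] at h1
  rw [mutualInfo_source_aux hp hW] at h2
  -- The corner of `V` lies in the Berger-Tung region, yet its functional is at most that of `W`,
  -- which is below `u`.
  obtain ⟨V, hV, hVW⟩ := exists_channel_card_eq hp hW i φ
  have hB := hfB _ (corner_mem_btRegion hp hV i)
  rw [hf] at hB
  have hr : ∀ j, φ.1 j * (corner p i W).1 j ≤ φ.1 j * x.1 j := by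
    intro j
    refine mul_le_mul_of_nonneg_left ?_ (hφ1 j)
    have : ∀ i j : Fin 2, j = i ∨ j = i + 1 := by decide
    rcases this i j with rfl | rfl
    · simpa [corner] using h1
    · simpa [corner] using h2
  have hfx' := hf x
  simp only [Fin.sum_univ_two] at hB hVW hfx'
  have hdist := mul_le_mul_of_nonneg_left hd.le hM0
  have e0 : (corner p i W).2 0 = distortion p W 0 := rfl
  have e1 : (corner p i W).2 1 = distortion p W 1 := rfl
  rw [e0, e1] at hVW
  have hMα' : φ.2 1 = M - M * α := by rw [hMα, hM]; ring
  rw [hMα', ← hMα] at hVW hfx' hB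
  have := hr 0
  have := hr 1
  linarith

end Regions

end LogLoss

end

theorem proposition4 {Y : Fin 2 → Type*} [∀ i, Fintype (Y i)]
    (p : (∀ i, Y i) → ℝ) (hp : p ∈ stdSimplex ℝ (∀ i, Y i)) :
    LogLoss.btRegion p =
      convexHull ℝ (LogLoss.swzRegion p 0 ∪ LogLoss.swzRegion p 1) :=
  Set.Subset.antisymm (LogLoss.btRegion_subset hp)
    (convexHull_min (Set.union_subset (LogLoss.swzRegion_subset hp 0)
      (LogLoss.swzRegion_subset hp 1)) (LogLoss.convex_btRegion hp))
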